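/- \textbf{Theorem 1.} Let $g\in\mathbb R$ be the gravitational acceleration. Consider a quad-rotor with position $(x,y,z)$, roll $\phi$, pitch $\theta$, yaw $\psi$ and inputs $u_1,\dots,u_4$, modelled for $t\ge 0$ by $$\ddot x=u_1(\cos\psi\sin\theta\cos\phi+\sin\psi\sin\phi),\quad \ddot y=u_1(\sin\psi\sin\theta\cos\phi-\cos\psi\sin\phi),\quad \ddot z=u_1\cos\theta\cos\phi-g,$$ $$\ddot\phi=u_2,\quad \ddot\theta=u_3,\quad \ddot\psi=u_4 .$$ Let $(x_d,y_d,z_d)$ be a reference trajectory on $[0,\infty)$ that is four times differentiable, with bounded derivatives of orders $1$ to $4$ and with $|\ddot z_d(t)|<g$ for all $t\ge 0$; let $(d_x,d_y,d_z)\in\mathbb R^3$ be constant, and put $e_x=x-x_d-d_x$, $e_y=y-y_d-d_y$, $e_z=z-z_d-d_z$. Let the gains satisfy $k_{1,\psi},k_{2,\psi},k_{1,z},k_{2,z},k_{3,z}>0$ and $k_{1,z}+k_{3,z}<g-|\ddot z_d(t)|$ for all $t\ge 0$, and let the polynomials $s^4+k_{4,x}s^3+k_{3,x}s^2+k_{2,x}s+k_{1,x}$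 and $s^4+k_{4,y}s^3+k_{3,y}s^2+k_{2,y}s+k_{1,y}$ be Hurwitz (all complex roots have negative real part). Set $$\bar u_1=g+\ddot z_d-k_{1,z}\tanh(\dot e_z+k_{2,z}e_z)-k_{3,z}\tanh\dot e_z,\qquad R_2(a)=\begin{bmatrix}\cos a&-\sin a\\ \sin a&\cos a\end{bmatrix},\qquad S=\begin{bmatrix}1&0\\0&-1\end{bmatrix},$$ $$v=\begin{bmatrix}\tan\theta\\ \tan\phi/\cos\theta\end{bmatrix},\qquad M=\begin{bmatrix}0&\sec^2\theta\\ \sec^2\phi\sec\theta&\tan\phi\tan\theta\sec\theta\end{bmatrix},\qquad \omega=\begin{bmatrix}\dot\phi\\ \dot\theta\end{bmatrix},$$ and apply the feedback laws $$u_4=-k_{1,\psi}\psi-k_{2,\psi}\dot\psi,\qquad u_1=\frac{\bar u_1}{\cos\theta\cos\phi},\qquad \begin{bmatrix}u_2\\u_3\end{bmatrix}=\frac{M^{-1}S^{-1}R_2(\psi)^{-1}}{\bar u_1}\left\{\begin{bmatrix}x_d^{(4)}\\y_d^{(4)}\end{bmatrix}-\Xi_2+\begin{bmatrix}u_x\\u_y\end{bmatrix}\right\},$$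 $$u_x=-k_{1,x}e_x-k_{2,x}\dot e_x-k_{3,x}\ddot e_x-k_{4,x}e_x^{(3)},\qquad u_y=-k_{1,y}e_y-k_{2,y}\dot e_y-k_{3,y}\ddot e_y-k_{4,y}e_y^{(3)},$$ where $$\Xi_1=(\dot{\bar u}_1R_2+\bar u_1\dot R_2)Sv,\qquad \Xi_2=\dot\Xi_1+\left(\dot{\bar u}_1R_2SM+\bar u_1\dot R_2SM+\bar u_1R_2S\dot M\right)\omega ,$$ $R_2=R_2(\psi)$, and the quantities $\ddot e_x,\ddot e_y,e_x^{(3)},e_y^{(3)},\dot{\bar u}_1,\dot\Xi_1,\dot R_2,\dot M$ in the feedback law denote the functions of time and of the twelve states (positions, angles and their first derivatives) that are obtained by carrying out the differentiations along $\dot v=M\omega$, $\ddot e_z=-k_{1,z}\tanh(\dot e_z+k_{2,z}e_z)-k_{3,z}\tanh\dot e_z$, $\ddot\psi=u_4$, with $\dot\omega$ not occurring; in particular $$\begin{bmatrix}\ddot e_x\\ \ddot e_y\end{bmatrix}=\bar u_1R_2Sv-\begin{bmatrix}\ddot x_d\\ \ddot y_d\end{bmatrix},\qquad \begin{bmatrix}e_x^{(3)}\\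 e_y^{(3)}\end{bmatrix}=\Xi_1+\bar u_1R_2SM\omega-\begin{bmatrix}x_d^{(3)}\\ y_d^{(3)}\end{bmatrix}.$$ Then: (a) From every initial state with $\phi(0),\theta(0)\in(-\pi/2,\pi/2)$ there is a closed-loop motion on $[0,\infty)$, with $\phi(t),\theta(t)\in(-\pi/2,\pi/2)$ for all $t\ge 0$. (b) For every closed-loop motion on $[0,\infty)$ with $\phi(0),\theta(0)\in(-\pi/2,\pi/2)$, as $t\to\infty$, $$x-x_d\to d_x,\qquad y-y_d\to d_y,\qquad z-z_d\to d_z,\qquad \psi\to 0 .$$ (c) For all such motions, $e_x,e_y$ are four times differentiable and converge to zero exponentially, together with their first three derivatives, globally and uniformly: there are $C,c>0$, depending on $g$ and the gains only (not on the reference, the offset or the motion), such that $|e^{(k)}(t)|\le Ce^{-ct}\sum_{j=0}^{3}|e^{(j)}(0)|$ for $e\in\{e_x,e_y\}$, $0\le k\le 3$, $t\ge 0$. (d) For all such motions, $e_z,\dot e_z,\ddot e_z$ converge to zero asymptotically, globally and uniformly: for every $\varepsilon>0$ there is $\delta>0$ such that $|e_z(0)|,|\dot e_z(0)|<\delta$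 implies $|e_z|,|\dot e_z|,|\ddot e_z|<\varepsilon$ on $[0,\infty)$; and for all $\rho,\varepsilon>0$ there is $T\ge 0$ such that $|e_z(0)|,|\dot e_z(0)|<\rho$ implies $|e_z|,|\dot e_z|,|\ddot e_z|<\varepsilon$ on $[T,\infty)$. Here $\delta$ and $T$ depend on $g$ and the gains, besides $\varepsilon$ and $\rho$, but not on the reference, the offset or the motion. -/

import Mathlib

open Real Set Filter Topology Matrix

namespace Quadrotor

noncomputable section

/-- The `k`-th time derivative of a signal on `[0, ∞)` (one-sided at time `0`). -/
def der (k : ℕ) (f : ℝ → ℝ) (t : ℝ) : ℝ := iteratedDerivWithin k f (Ici 0) t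

/-- `f` is `n` times differentiable on `[0, ∞)`. -/
def TimesDiff (n : ℕ) (f : ℝ → ℝ) : Prop := ∀ k < n, DifferentiableOn ℝ (der k f) (Ici 0)

/-- Position and attitude (roll `φ`, pitch `θ`, yaw `ψ`), or the rates of these coordinates. -/
structure Config where
  (x y z φ θ ψ : ℝ)

/-- A motion of the quad-rotor: position and attitude (roll, pitch, yaw) as functions of time. -/
structure Trajectory where
  (x y z φ θ ψ : ℝ → ℝ)

/-- Initial position and attitude `p`, initial velocities and angular rates `v`. -/
structure Trajectory.HasInitialState (q : Trajectory) (p v : Config) : Prop where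
  x : q.x 0 = p.x
  y : q.y 0 = p.y
  z : q.z 0 = p.z
  φ : q.φ 0 = p.φ
  θ : q.θ 0 = p.θ
  ψ : q.ψ 0 = p.ψ
  dx : der 1 q.x 0 = v.x
  dy : der 1 q.y 0 = v.y
  dz : der 1 q.z 0 = v.z
  dφ : der 1 q.φ 0 = v.φ
  dθ : der 1 q.θ 0 = v.θ
  dψ : der 1 q.ψ 0 = v.ψ

/-- The quad-rotor model with gravity `g`, driven by the inputs `u₁` (lift per unit of mass) and
`u₂, u₃, u₄` (virtual torques), on the time interval `[0, ∞)`. -/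
structure IsMotion (g : ℝ) (q : Trajectory) (u₁ u₂ u₃ u₄ : ℝ → ℝ) : Prop where
  diff_x : TimesDiff 2 q.x
  diff_y : TimesDiff 2 q.y
  diff_z : TimesDiff 2 q.z
  diff_φ : TimesDiff 2 q.φ
  diff_θ : TimesDiff 2 q.θ
  diff_ψ : TimesDiff 2 q.ψ
  eq_x : ∀ t ≥ 0, der 2 q.x t =
    u₁ t * (cos (q.ψ t) * sin (q.θ t) * cos (q.φ t) + sin (q.ψ t) * sin (q.φ t))
  eq_y : ∀ t ≥ 0, der 2 q.y t =
    u₁ t * (sin (q.ψ t) * sin (q.θ t) * cos (q.φ t) - cos (q.ψ t) * sin (q.φ t))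
  eq_z : ∀ t ≥ 0, der 2 q.z t = u₁ t * cos (q.θ t) * cos (q.φ t) - g
  eq_φ : ∀ t ≥ 0, der 2 q.φ t = u₂ t
  eq_θ : ∀ t ≥ 0, der 2 q.θ t = u₃ t
  eq_ψ : ∀ t ≥ 0, der 2 q.ψ t = u₄ t

/-- The reference trajectory. -/
structure Reference where
  (x y z : ℝ → ℝ)

/-- Four times differentiable on `[0, ∞)` with bounded derivatives of orders one to four. -/
def SmoothBounded (f : ℝ → ℝ) : Prop :=
  TimesDiff 4 f ∧ ∃ B : ℝ, ∀ k ∈ Finset.Icc 1 4, ∀ t ≥ 0, |der k f t| ≤ B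

structure Reference.Admissible (g : ℝ) (r : Reference) : Prop where
  smooth_x : SmoothBounded r.x
  smooth_y : SmoothBounded r.y
  smooth_z : SmoothBounded r.z
  acc_lt : ∀ t ≥ 0, |der 2 r.z t| < g

/-- The constant displacement from the reference. -/
structure Offset where
  (x y z : ℝ)

structure Gains where
  (k1x k2x k3x k4x k1y k2y k3y k4y k1z k2z k3z k1ψ k2ψ : ℝ)

/-- The linear system `e⁽⁴⁾ = -k₁ e - k₂ e' - k₃ e'' - k₄ e⁽³⁾` has a Hurwitz characteristic
polynomial. -/
def Hurwitz (k₁ k₂ k₃ k₄ : ℝ) : Prop :=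
  ∀ s : ℂ, s ^ 4 + k₄ * s ^ 3 + k₃ * s ^ 2 + k₂ * s + k₁ = 0 → s.re < 0

structure Gains.Admissible (K : Gains) : Prop where
  hurwitz_x : Hurwitz K.k1x K.k2x K.k3x K.k4x
  hurwitz_y : Hurwitz K.k1y K.k2y K.k3y K.k4y
  k1z_pos : 0 < K.k1z
  k2z_pos : 0 < K.k2z
  k3z_pos : 0 < K.k3z
  k1ψ_pos : 0 < K.k1ψ
  k2ψ_pos : 0 < K.k2ψ

/-! Tracking errors. -/

def errX (r : Reference) (d : Offset) (q : Trajectory) (t : ℝ) : ℝ := q.x t - r.x t - d.x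

def errY (r : Reference) (d : Offset) (q : Trajectory) (t : ℝ) : ℝ := q.y t - r.y t - d.y

def errZ (r : Reference) (d : Offset) (q : Trajectory) (t : ℝ) : ℝ := q.z t - r.z t - d.z

/-! Yaw and thrust. -/

/-- The yaw input `u₄`. -/
def yawInput (K : Gains) (q : Trajectory) (t : ℝ) : ℝ :=
  -K.k1ψ * q.ψ t - K.k2ψ * der 1 q.ψ t

/-- The intermediate thrust variable `ū₁`. -/
def ubar (g : ℝ) (K : Gains) (r : Reference) (d : Offset) (q : Trajectory) (t : ℝ) : ℝ :=
  g + der 2 r.z t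
    - K.k1z * tanh (der 1 (errZ r d q) t + K.k2z * errZ r d q t)
    - K.k3z * tanh (der 1 (errZ r d q) t)

/-- The thrust input `u₁`. -/
def thrustInput (g : ℝ) (K : Gains) (r : Reference) (d : Offset) (q : Trajectory) (t : ℝ) : ℝ :=
  1 / (cos (q.θ t) * cos (q.φ t)) * ubar g K r d q t

/-- The second derivative of the altitude error in closed loop, as a function of the state. -/
def accZ (K : Gains) (r : Reference) (d : Offset) (q : Trajectory) (t : ℝ) : ℝ :=
  -K.k1z * tanh (der 1 (errZ r d q) t + K.k2z * errZ r d q t)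
    - K.k3z * tanh (der 1 (errZ r d q) t)

/-- The third derivative of the altitude error in closed loop, as a function of the state. -/
def jerkZ (K : Gains) (r : Reference) (d : Offset) (q : Trajectory) (t : ℝ) : ℝ :=
  -K.k1z * (1 - tanh (der 1 (errZ r d q) t + K.k2z * errZ r d q t) ^ 2)
      * (accZ K r d q t + K.k2z * der 1 (errZ r d q) t)
    - K.k3z * (1 - tanh (der 1 (errZ r d q) t) ^ 2) * accZ K r d q t

/-- The first derivative of `ubar` in closed loop, as a function of the state. -/
def ubarD (K : Gains) (r : Reference) (d : Offset) (q : Trajectory) (t : ℝ) : ℝ :=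
  der 3 r.z t
    - K.k3z * (1 - tanh (der 1 (errZ r d q) t) ^ 2) * accZ K r d q t
    - K.k1z * (1 - tanh (der 1 (errZ r d q) t + K.k2z * errZ r d q t) ^ 2)
      * (accZ K r d q t + K.k2z * der 1 (errZ r d q) t)

/-- The second derivative of `ubar` in closed loop, as a function of the state. -/
def ubarDD (K : Gains) (r : Reference) (d : Offset) (q : Trajectory) (t : ℝ) : ℝ :=
  der 4 r.z t
    + 2 * K.k1z * (1 - tanh (der 1 (errZ r d q) t + K.k2z * errZ r d q t) ^ 2)
      * (accZ K r d q t + K.k2z * der 1 (errZ r d q) t) ^ 2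
      * tanh (der 1 (errZ r d q) t + K.k2z * errZ r d q t)
    - K.k1z * (1 - tanh (der 1 (errZ r d q) t + K.k2z * errZ r d q t) ^ 2)
      * (jerkZ K r d q t + K.k2z * accZ K r d q t)
    + 2 * K.k3z * (1 - tanh (der 1 (errZ r d q) t) ^ 2) * accZ K r d q t ^ 2
      * tanh (der 1 (errZ r d q) t)
    - K.k3z * (1 - tanh (der 1 (errZ r d q) t) ^ 2) * jerkZ K r d q t

/-! Roll and pitch. -/

def R2 (a : ℝ) : Matrix (Fin 2) (Fin 2) ℝ := !![cos a, -sin a; sin a, cos a]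

def S : Matrix (Fin 2) (Fin 2) ℝ := !![1, 0; 0, -1]

/-- The Jacobian of `(tan θ, tan φ / cos θ)` with respect to `(φ, θ)`. -/
def M (φ θ : ℝ) : Matrix (Fin 2) (Fin 2) ℝ :=
  !![0, 1 / cos θ ^ 2;
    1 / cos φ ^ 2 * (1 / cos θ), tan φ * tan θ * (1 / cos θ)]

/-- The time derivative of `M (φ, θ)` along the angular rates `(dφ, dθ)`. -/
def MD (φ θ dφ dθ : ℝ) : Matrix (Fin 2) (Fin 2) ℝ :=
  !![0, 2 * dθ * (1 / cos θ ^ 2) * tan θ;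
    2 * dφ * (1 / cos φ ^ 2) * tan φ * (1 / cos θ) + dθ * (1 / cos φ ^ 2) * tan θ * (1 / cos θ),
    dφ * (1 / cos φ ^ 2) * tan θ * (1 / cos θ)
      + dθ * tan φ * (1 / cos θ ^ 3 + tan θ ^ 2 * (1 / cos θ))]

/-- `M` along the motion. -/
def Mt (q : Trajectory) (t : ℝ) : Matrix (Fin 2) (Fin 2) ℝ := M (q.φ t) (q.θ t)

/-- The time derivative of `M` along the motion. -/
def MtD (q : Trajectory) (t : ℝ) : Matrix (Fin 2) (Fin 2) ℝ :=
  MD (q.φ t) (q.θ t) (der 1 q.φ t) (der 1 q.θ t)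

/-- The time derivative of `R2 ψ` along the motion. -/
def R2D (q : Trajectory) (t : ℝ) : Matrix (Fin 2) (Fin 2) ℝ :=
  der 1 q.ψ t • (R2 (π / 2) * R2 (q.ψ t))

/-- The second time derivative of `R2 ψ` in closed loop (where `ψ'' = u₄`). -/
def R2DD (K : Gains) (q : Trajectory) (t : ℝ) : Matrix (Fin 2) (Fin 2) ℝ :=
  yawInput K q t • (R2 (π / 2) * R2 (q.ψ t))
    + der 1 q.ψ t ^ 2 • (R2 (π / 2) ^ 2 * R2 (q.ψ t))

/-- The vector `(tan θ, tan φ / cos θ)`. -/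
def tilt (q : Trajectory) (t : ℝ) : Fin 2 → ℝ := ![tan (q.θ t), tan (q.φ t) / cos (q.θ t)]

/-- The vector `(φ', θ')`. -/
def rates (q : Trajectory) (t : ℝ) : Fin 2 → ℝ := ![der 1 q.φ t, der 1 q.θ t]

def Xi1 (g : ℝ) (K : Gains) (r : Reference) (d : Offset) (q : Trajectory) (t : ℝ) : Fin 2 → ℝ :=
  ((ubarD K r d q t • R2 (q.ψ t) + ubar g K r d q t • R2D q t) * S) *ᵥ tilt q t

/-- The time derivative of `Xi1` in closed loop, as a function of the state. -/
def Xi1D (g : ℝ) (K : Gains) (r : Reference) (d : Offset) (q : Trajectory) (t : ℝ) : Fin 2 → ℝ :=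
  ((ubarDD K r d q t • R2 (q.ψ t) + (2 * ubarD K r d q t) • R2D q t
      + ubar g K r d q t • R2DD K q t) * S) *ᵥ tilt q t
    + ((ubarD K r d q t • R2 (q.ψ t) + ubar g K r d q t • R2D q t) * S * Mt q t) *ᵥ rates q t

def Xi2 (g : ℝ) (K : Gains) (r : Reference) (d : Offset) (q : Trajectory) (t : ℝ) : Fin 2 → ℝ :=
  Xi1D g K r d q t
    + (ubarD K r d q t • (R2 (q.ψ t) * S * Mt q t)
        + ubar g K r d q t • (R2D q t * S * Mt q t)
        + ubar g K r d q t • (R2 (q.ψ t) * S * MtD q t)) *ᵥ rates q t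

/-- The second derivatives of the horizontal errors in closed loop, as a function of the state. -/
def accXY (g : ℝ) (K : Gains) (r : Reference) (d : Offset) (q : Trajectory) (t : ℝ) : Fin 2 → ℝ :=
  (ubar g K r d q t • (R2 (q.ψ t) * S)) *ᵥ tilt q t - ![der 2 r.x t, der 2 r.y t]

/-- The third derivatives of the horizontal errors in closed loop, as a function of the state. -/
def jerkXY (g : ℝ) (K : Gains) (r : Reference) (d : Offset) (q : Trajectory) (t : ℝ) :
    Fin 2 → ℝ :=
  Xi1 g K r d q t + (ubar g K r d q t • (R2 (q.ψ t) * S * Mt q t)) *ᵥ rates q t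
    - ![der 3 r.x t, der 3 r.y t]

/-- The linear feedback `(u_x, u_y)`. -/
def linearInput (g : ℝ) (K : Gains) (r : Reference) (d : Offset) (q : Trajectory) (t : ℝ) :
    Fin 2 → ℝ :=
  ![-K.k1x * errX r d q t - K.k2x * der 1 (errX r d q) t
      - K.k3x * accXY g K r d q t 0 - K.k4x * jerkXY g K r d q t 0,
    -K.k1y * errY r d q t - K.k2y * der 1 (errY r d q) t
      - K.k3y * accXY g K r d q t 1 - K.k4y * jerkXY g K r d q t 1]

/-- The roll and pitch inputs `(u₂, u₃)`. -/
def rollPitchInput (g : ℝ) (K : Gains) (r : Reference) (d : Offset) (q : Trajectory) (t : ℝ) :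
    Fin 2 → ℝ :=
  (1 / ubar g K r d q t) • (((Mt q t)⁻¹ * S⁻¹ * (R2 (q.ψ t))⁻¹) *ᵥ
    (![der 4 r.x t, der 4 r.y t] - Xi2 g K r d q t + linearInput g K r d q t))

/-- The quad-rotor moves under the feedback laws. -/
def ClosedLoop (g : ℝ) (K : Gains) (r : Reference) (d : Offset) (q : Trajectory) : Prop :=
  IsMotion g q (thrustInput g K r d q) (fun t => rollPitchInput g K r d q t 0)
    (fun t => rollPitchInput g K r d q t 1) (yawInput K q)

/-- The thrust gains respect the reference altitude acceleration: `k₁z + k₃z < g - |z_d''|`. -/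
def ThrustBound (g : ℝ) (K : Gains) (r : Reference) : Prop :=
  ∀ t ≥ 0, K.k1z + K.k3z < g - |der 2 r.z t|

/-- A closed-loop motion with an admissible reference, whose roll and pitch start in
`(-π/2, π/2)`. -/
structure Tracks (g : ℝ) (K : Gains) (r : Reference) (d : Offset) (q : Trajectory) : Prop where
  ref : r.Admissible g
  bound : ThrustBound g K r
  loop : ClosedLoop g K r d q
  roll : q.φ 0 ∈ Ioo (-(π / 2)) (π / 2)
  pitch : q.θ 0 ∈ Ioo (-(π / 2)) (π / 2)

end

end Quadrotor

namespace Quadrotor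

/-! ### Global solutions of autonomous Lipschitz equations -/

/-! The feedback linearizes the dynamics exactly as long as `cos φ` and `cos θ` do not vanish. The
thrust law turns the vertical equation into the autonomous equation `e'' = -k₁ tanh (e' + k₂ e) - k₃
tanh e'` for the altitude error, and the yaw equation is linear. The horizontal acceleration is `ū₁
R₂(ψ) S v` with `v` the tilt vector. Two further differentiations bring in `φ''` and `θ''` through
the matrix `ū₁ R₂ S M`, which is invertible because the thrust gains keep `ū₁` positive (`ubar_pos`,
`thrust_mulVec_eq_iff`). The torque law inverts this matrix and leaves `e⁽⁴⁾ = -k₁ e - k₂ e' - k₃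
e'' - k₄ e⁽³⁾` for each horizontal error.

These equations are solved separately. A linear equation whose characteristic roots have negative
real part decays exponentially, by splitting off one root at a time (`exists_exponential_bound`).
The altitude equation has a strict Lyapunov function with compact sublevel sets
(`altitudeError_stable`, `altitudeError_attractive`).

No singularity can be reached in finite time (`Tracks.upright`). While the attitude is regular, the
linear equation bounds the horizontal acceleration errors, hence the horizontal accelerations; since
`ū₁` is bounded below on compact time intervals, `tan θ` and `tan φ / cos θ` stay bounded, which
keeps both angles away from `±π/2`.

Existence is obtained without solving the closed loop as a differential equation, whose right-hand
side contains fourth derivatives of the reference that need not be continuous. Instead the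
autonomous error equations are solved on the whole line, position and yaw are read off, and roll and
pitch are recovered from the accelerations by `arctan`; the result satisfies the feedback law
(`ErrorSystem.closedLoop`). No uniqueness is needed, since the convergence statements are proved for
an arbitrary motion. -/

open scoped Manifold in
theorem exists_forall_hasDerivAt_of_uniform_time {E : Type*} [NormedAddCommGroup E]
    [NormedSpace ℝ E] [CompleteSpace E] {f : E → E} (hf : ContDiff ℝ 1 f) {ε : ℝ} (hε : 0 < ε)
    (h : ∀ x : E, ∃ γ : ℝ → E, γ 0 = x ∧ ∀ t ∈ Ioo (-ε) ε, HasDerivAt γ (f (γ t)) t) (x : E) :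
    ∃ γ : ℝ → E, γ 0 = x ∧ ∀ t, HasDerivAt γ (f (γ t)) t := by
  have h' : ∀ x : E, ∃ γ : ℝ → E, γ 0 = x ∧
      IsMIntegralCurveOn (I := 𝓘(ℝ, E)) γ (fun x => (f x : TangentSpace 𝓘(ℝ, E) x))
        (Ioo (-ε) ε) := by
    intro x
    obtain ⟨γ, h0, h1⟩ := h x
    exact ⟨γ, h0, fun t ht =>
      hasMFDerivWithinAt_iff_hasFDerivWithinAt.2 (h1 t ht).hasDerivWithinAt.hasFDerivWithinAt⟩
  -- Local solutions with a common lifespan extend to all times. The extension theorem concerns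
  -- vector fields on manifolds, so `E` is regarded as a manifold modelled on itself.
  obtain ⟨γ, h0, h1⟩ := exists_isMIntegralCurve_of_isMIntegralCurveOn (I := 𝓘(ℝ, E))
    (v := fun x => (f x : TangentSpace 𝓘(ℝ, E) x)) (contMDiff_vectorSpace_iff_contDiff.2 hf) hε h' x
  refine ⟨γ, h0, fun t => ?_⟩
  have h2 : HasFDerivAt γ ((1 : ℝ →L[ℝ] ℝ).smulRight (f (γ t))) t :=
    hasMFDerivAt_iff_hasFDerivAt.1 (h1 t)
  simpa using h2.hasDerivAt

theorem exists_forall_hasDerivAt_of_lipschitz {E : Type*} [NormedAddCommGroup E]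
    [NormedSpace ℝ E] [CompleteSpace E] {f : E → E} (hf : ContDiff ℝ 1 f) {K : NNReal}
    (hK : LipschitzWith K f) (x : E) :
    ∃ γ : ℝ → E, γ 0 = x ∧ ∀ t, HasDerivAt γ (f (γ t)) t := by
  have hpos : (0 : ℝ) < 1 / (1 + K) := by positivity
  refine exists_forall_hasDerivAt_of_uniform_time hf hpos (fun x => ?_) x
  -- On the ball of radius `‖f x‖` about `x` the field is at most `(1 + K) * ‖f x‖`, so the
  -- guaranteed time is the quotient `1 / (1 + K)`, whatever the point `x`.
  have hpl : IsPicardLindelof (fun _ => f) (tmin := -(1 / (1 + K : ℝ))) (tmax := 1 / (1 + K : ℝ))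
      ⟨0, by simp; positivity⟩ x ‖f x‖₊ 0 ((1 + K) * ‖f x‖₊) K := by
    refine ⟨fun t _ => hK.lipschitzOnWith, fun _ _ => continuousOn_const, fun t _ y hy => ?_, ?_⟩
    · have h1 : ‖f y - f x‖ ≤ K * ‖y - x‖ := hK.norm_sub_le y x
      have h2 : ‖y - x‖ ≤ ‖f x‖ := by simpa [dist_eq_norm] using hy
      have h3 : ‖f y‖ ≤ ‖f x‖ + ‖f y - f x‖ := by
        simpa using norm_add_le (f x) (f y - f x)
      have h4 : (K : ℝ) * ‖y - x‖ ≤ K * ‖f x‖ := by gcongr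
      push_cast
      linarith
    · have : (1 + K : ℝ) ≠ 0 := by positivity
      simp
      field_simp
      rfl
  obtain ⟨α, h0, h1⟩ := hpl.exists_eq_forall_mem_Icc_hasDerivWithinAt₀
  exact ⟨α, h0, fun t ht => (h1 t (Ioo_subset_Icc_self ht)).hasDerivAt (Icc_mem_nhds ht.1 ht.2)⟩

/-! ### Time derivatives on `[0, ∞)` -/

theorem der_zero (f : ℝ → ℝ) : der 0 f = f := by
  funext t
  simp [der]

theorem TimesDiff.hasDerivWithinAt {n k : ℕ} {f : ℝ → ℝ} (hf : TimesDiff n f) (hk : k < n) {t : ℝ}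
    (ht : 0 ≤ t) : HasDerivWithinAt (der k f) (der (k + 1) f t) (Ici 0) t := by
  have := ((hf k hk) t ht).hasDerivWithinAt
  rwa [show derivWithin (der k f) (Ici 0) t = der (k + 1) f t by
    unfold der; rw [iteratedDerivWithin_succ]] at this

theorem TimesDiff.hasDerivWithinAt_zero {n : ℕ} {f : ℝ → ℝ} (hf : TimesDiff n f) (hn : 0 < n)
    {t : ℝ} (ht : 0 ≤ t) : HasDerivWithinAt f (der 1 f t) (Ici 0) t := by
  simpa [der_zero] using hf.hasDerivWithinAt hn ht

/-- Derivatives within a half-line are unique, so exhibiting the successive derivatives of a signal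
identifies its iterated ones. All higher derivatives of the errors are computed in this way. -/
theorem eqOn_der_of_chain {n : ℕ} {F : ℕ → ℝ → ℝ}
    (h : ∀ k < n, ∀ t ≥ 0, HasDerivWithinAt (F k) (F (k + 1) t) (Ici 0) t) :
    ∀ k ≤ n, EqOn (der k (F 0)) (F k) (Ici 0) := by
  intro k
  induction k with
  | zero => intro _ t _; rw [der_zero]
  | succ k ih =>
    intro hk t ht
    have h1 := (h k hk t ht).congr (ih (by omega)) (ih (by omega) ht)
    have := h1.derivWithin (uniqueDiffOn_Ici 0 t ht)
    rw [← this]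
    unfold der
    rw [iteratedDerivWithin_succ]

theorem timesDiff_of_chain {n : ℕ} {F : ℕ → ℝ → ℝ}
    (h : ∀ k < n, ∀ t ≥ 0, HasDerivWithinAt (F k) (F (k + 1) t) (Ici 0) t) :
    TimesDiff n (F 0) := fun k hk t ht =>
  ((h k hk t ht).congr (eqOn_der_of_chain h k hk.le)
    (eqOn_der_of_chain h k hk.le ht)).differentiableWithinAt

/-! ### Linear equations with constant coefficients -/

/-- The integrating factor `exp (-a t)` removes the linear term. What remains has derivative at most
`A exp (m t)` with `m = -a.re - c > 0`, and is compared with `‖f 0‖ + (A / m) exp (m t)`. -/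
theorem norm_le_of_hasDerivWithinAt_linear {f h : ℝ → ℂ} {a : ℂ} {T A c : ℝ} (hc : c < -a.re)
    (hA : 0 ≤ A)
    (hf : ∀ t ∈ Ico 0 T, HasDerivWithinAt f (a * f t + h t) (Ici 0) t)
    (hh : ∀ t ∈ Ico 0 T, ‖h t‖ ≤ A * exp (-c * t)) :
    ∀ t ∈ Ico 0 T, ‖f t‖ ≤ (‖f 0‖ + A / (-a.re - c)) * exp (-c * t) := by
  intro t ht
  set m := -a.re - c with hm
  have hm0 : 0 < m := by linarith
  have hg : ∀ s ∈ Ico 0 T, HasDerivWithinAt (fun s : ℝ => Complex.exp (-a * s) * f s)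
      (Complex.exp (-a * s) * h s) (Ici 0) s := by
    intro s hs
    have h1 : HasDerivAt (fun s : ℝ => Complex.exp (-a * s)) (Complex.exp (-a * s) * (-a)) s := by
      have := ((hasDerivAt_id (s : ℂ)).const_mul (-a)).cexp.comp_ofReal
      simpa using this
    refine (h1.hasDerivWithinAt.mul (hf s hs)).congr_deriv ?_
    ring
  have hn : ∀ s : ℝ, ‖Complex.exp (-a * s)‖ = exp (m * s + c * s) := by
    intro s
    rw [Complex.norm_exp]
    simp [hm]
    ring
  have hB : ∀ s : ℝ, HasDerivAt (fun s => ‖f 0‖ + A / m * exp (m * s)) (A * exp (m * s)) s := by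
    intro s
    have := (((hasDerivAt_id s).const_mul m).exp.const_mul (A / m)).const_add ‖f 0‖
    refine this.congr_deriv ?_
    simp
    field_simp
  have key := image_norm_le_of_norm_deriv_right_le_deriv_boundary (a := 0) (b := t)
    (f := fun s : ℝ => Complex.exp (-a * s) * f s)
    (fun s hs => (hg s ⟨hs.1, hs.2.trans_lt ht.2⟩).continuousWithinAt.mono Icc_subset_Ici_self)
    (fun s hs => (hg s ⟨hs.1, hs.2.trans ht.2⟩).mono (Ici_subset_Ici.2 hs.1))
    (by simp; positivity) hB
    (fun s hs => by
      rw [norm_mul, hn]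
      calc exp (m * s + c * s) * ‖h s‖
          ≤ exp (m * s + c * s) * (A * exp (-c * s)) := by
            gcongr
            exact hh s ⟨hs.1, hs.2.trans ht.2⟩
        _ = A * (exp (m * s + c * s) * exp (-c * s)) := by ring
        _ = A * exp (m * s) := by rw [← exp_add]; ring_nf)
    (right_mem_Icc.2 ht.1)
  rw [norm_mul, hn] at key
  have e1 : ‖f t‖ = exp (-(m * t + c * t)) * (exp (m * t + c * t) * ‖f t‖) := by
    rw [← mul_assoc, ← exp_add]
    simp
  rw [e1]
  calc exp (-(m * t + c * t)) * (exp (m * t + c * t) * ‖f t‖)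
      ≤ exp (-(m * t + c * t)) * (‖f 0‖ + A / m * exp (m * t)) := by gcongr
    _ ≤ exp (-(m * t + c * t)) * (‖f 0‖ * exp (m * t) + A / m * exp (m * t)) := by
        gcongr
        exact le_mul_of_one_le_right (norm_nonneg _) (one_le_exp (mul_nonneg hm0.le ht.1))
    _ = (‖f 0‖ + A / m) * (exp (-(m * t + c * t)) * exp (m * t)) := by ring
    _ = (‖f 0‖ + A / m) * exp (-c * t) := by rw [← exp_add]; ring_nf

open Polynomial in
-- With `e k` the `k`-th derivative of a signal, this is the factorization of differential operators
-- `((X - a) q)(D) e = q(D) (e' - a e)`.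
theorem sum_coeff_X_sub_C_mul {R : Type*} [CommRing R] {q : R[X]} {n : ℕ} (hq : q.natDegree ≤ n)
    (a : R) (e : ℕ → R) :
    ∑ k ∈ Finset.range (n + 2), ((X - C a) * q).coeff k * e k =
      ∑ k ∈ Finset.range (n + 1), q.coeff k * (e (k + 1) - a * e k) := by
  have h1 : ∀ k, ((X - C a) * q).coeff k * e k = (X * q).coeff k * e k - a * (q.coeff k * e k) := by
    intro k
    rw [sub_mul, coeff_sub, coeff_C_mul]
    ring
  rw [Finset.sum_congr rfl fun k _ => h1 k, Finset.sum_sub_distrib, Finset.sum_range_succ',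
    ← Finset.mul_sum, Finset.sum_range_succ (fun k => q.coeff k * e k) (n + 1),
    coeff_eq_zero_of_natDegree_lt (by omega : q.natDegree < n + 1)]
  simp only [coeff_X_mul, coeff_X_mul_zero, zero_mul, add_zero, mul_sub, Finset.sum_sub_distrib,
    Finset.mul_sum]
  congr 1
  exact Finset.sum_congr rfl fun k _ => by ring

open Polynomial in
-- Induction on the degree, splitting off a root `a`. The signals `e (k + 1) - a e k` obey the
-- equation of the cofactor and decay by induction; they force the first-order equation of `e 0`,
-- and the higher `e k` follow by back substitution. The constants do not depend on `T`, so the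
-- bound is available before a motion is known to stay regular for all times.
theorem exists_exponential_bound (n : ℕ) : ∀ p : ℂ[X], p.Monic → p.natDegree = n →
    (∀ s, p.IsRoot s → s.re < 0) → ∃ C > 0, ∃ c > 0, ∀ (T : ℝ) (e : ℕ → ℝ → ℂ),
      (∀ k < n, ∀ t ∈ Ico 0 T, HasDerivWithinAt (e k) (e (k + 1) t) (Ici 0) t) →
      (∀ t ∈ Ico 0 T, ∑ k ∈ Finset.range (n + 1), p.coeff k * e k t = 0) →
      ∀ k < n, ∀ t ∈ Ico 0 T,
        ‖e k t‖ ≤ C * exp (-c * t) * ∑ j ∈ Finset.range n, ‖e j 0‖ := by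
  induction n with
  | zero => intro p _ _ _; exact ⟨1, one_pos, 1, one_pos, fun _ _ _ _ k hk => by omega⟩
  | succ n ih =>
    intro p hp hdeg hroot
    obtain ⟨a, ha⟩ := IsAlgClosed.exists_root p (by
      rw [degree_eq_natDegree hp.ne_zero, hdeg]; exact_mod_cast n.succ_ne_zero)
    obtain ⟨q, rfl⟩ := dvd_iff_isRoot.2 ha
    have hq : q.Monic := (monic_X_sub_C a).of_mul_monic_left hp
    have hqdeg : q.natDegree = n := by
      rw [(monic_X_sub_C a).natDegree_mul hq, natDegree_X_sub_C] at hdeg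
      omega
    obtain ⟨C, hC, c, hc, H⟩ := ih q hq hqdeg fun s hs => hroot s (by
      simp only [IsRoot.def, eval_mul] at hs ⊢; rw [hs, mul_zero])
    have har := hroot a ha
    -- The rate must lie strictly below `-a.re`: a multiple root would otherwise produce a
    -- polynomial factor.
    set c' := min c (-a.re / 2) with hc'
    have hc'0 : 0 < c' := lt_min hc (by linarith)
    have hc'a : c' < -a.re := (min_le_right _ _).trans_lt (by linarith)
    set D := C * (1 + ‖a‖) + 1 with hD
    have hD0 : 0 < D := by positivity
    set N := 1 + D / (-a.re - c') with hN
    have hN0 : 1 ≤ N := by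
      have : 0 ≤ D / (-a.re - c') := div_nonneg hD0.le (by linarith)
      linarith
    refine ⟨(N + D) * (1 + ‖a‖) ^ n, by positivity, c', hc'0, fun T e he hsum => ?_⟩
    set S₀ := ∑ j ∈ Finset.range (n + 1), ‖e j 0‖ with hS
    have hS0 : 0 ≤ S₀ := Finset.sum_nonneg fun _ _ => norm_nonneg _
    have hf := H T (fun k t => e (k + 1) t - a * e k t)
      (fun k hk t ht => (he (k + 1) (by omega) t ht).sub ((he k (by omega) t ht).const_mul a))
      (fun t ht => by
        rw [← sum_coeff_X_sub_C_mul hqdeg.le a fun k => e k t]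
        exact hsum t ht)
    have hf0 : ∑ j ∈ Finset.range n, ‖e (j + 1) 0 - a * e j 0‖ ≤ (1 + ‖a‖) * S₀ := by
      calc ∑ j ∈ Finset.range n, ‖e (j + 1) 0 - a * e j 0‖
          ≤ ∑ j ∈ Finset.range n, (‖e (j + 1) 0‖ + ‖a‖ * ‖e j 0‖) := by
            gcongr with j
            exact (norm_sub_le _ _).trans (by rw [norm_mul])
        _ = ∑ j ∈ Finset.range n, ‖e (j + 1) 0‖ + ‖a‖ * ∑ j ∈ Finset.range n, ‖e j 0‖ := by
            rw [Finset.sum_add_distrib, Finset.mul_sum]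
        _ ≤ S₀ + ‖a‖ * S₀ := by
            gcongr
            · rw [hS, Finset.sum_range_succ']
              linarith [norm_nonneg (e 0 0)]
            · exact Finset.sum_le_sum_of_subset_of_nonneg (Finset.range_mono n.le_succ)
                fun _ _ _ => norm_nonneg _
        _ = _ := by ring
    have hfD : ∀ k < n, ∀ t ∈ Ico 0 T, ‖e (k + 1) t - a * e k t‖ ≤ D * S₀ * exp (-c' * t) := by
      intro k hk t ht
      calc ‖e (k + 1) t - a * e k t‖
          ≤ C * exp (-c * t) * ∑ j ∈ Finset.range n, ‖e (j + 1) 0 - a * e j 0‖ := hf k hk t ht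
        _ ≤ C * exp (-c' * t) * ((1 + ‖a‖) * S₀) := by
            gcongr
            · exact ht.1
            · exact min_le_left _ _
        _ = (C * (1 + ‖a‖)) * S₀ * exp (-c' * t) := by ring
        _ ≤ D * S₀ * exp (-c' * t) := by gcongr; linarith
    have h0 : ∀ t ∈ Ico 0 T, ‖e 0 t‖ ≤ N * S₀ * exp (-c' * t) := by
      intro t ht
      have hfirst : ∀ t ∈ Ico 0 T, ‖e 1 t - a * e 0 t‖ ≤ D * S₀ * exp (-c' * t) := by
        intro t ht
        rcases Nat.eq_zero_or_pos n with hn | hn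
        -- Here the induction hypothesis is empty; the cofactor is `1` and the equation itself says
        -- that the forcing vanishes.
        · subst hn
          have hq1 : q = 1 := eq_one_of_monic_natDegree_zero hq hqdeg
          have := hsum t ht
          rw [sum_coeff_X_sub_C_mul hqdeg.le a fun k => e k t] at this
          simp [hq1] at this
          rw [this, norm_zero]
          positivity
        · exact hfD 0 hn t ht
      have h1 := norm_le_of_hasDerivWithinAt_linear (f := e 0) (h := fun t => e 1 t - a * e 0 t)
        (T := T) hc'a (by positivity : 0 ≤ D * S₀)
        (fun t ht => (he 0 (by omega) t ht).congr_deriv (by ring)) hfirst t ht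
      refine h1.trans ?_
      gcongr
      have : ‖e 0 0‖ ≤ S₀ :=
        Finset.single_le_sum (f := fun j => ‖e j 0‖) (fun _ _ => norm_nonneg _)
          (Finset.mem_range.2 n.succ_pos)
      rw [hN]
      calc ‖e 0 0‖ + D * S₀ / (-a.re - c') ≤ S₀ + D * S₀ / (-a.re - c') := by gcongr
        _ = _ := by ring
    have hk : ∀ k < n + 1, ∀ t ∈ Ico 0 T,
        ‖e k t‖ ≤ (N + D) * (1 + ‖a‖) ^ k * (S₀ * exp (-c' * t)) := by
      intro k
      induction k with
      | zero =>
        intro _ t ht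
        refine (h0 t ht).trans ?_
        rw [mul_assoc, pow_zero, mul_one]
        gcongr
        linarith
      | succ k ihk =>
        intro hkn t ht
        have h1 := hfD k (by omega) t ht
        have h2 := ihk (by omega) t ht
        have h3 : ‖e (k + 1) t‖ ≤ ‖e (k + 1) t - a * e k t‖ + ‖a‖ * ‖e k t‖ := by
          rw [← norm_mul]
          simpa using norm_add_le (e (k + 1) t - a * e k t) (a * e k t)
        have hE : 0 ≤ S₀ * exp (-c' * t) := by positivity
        have h4 : D * S₀ * exp (-c' * t) ≤ (N + D) * (1 + ‖a‖) ^ k * (S₀ * exp (-c' * t)) := by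
          rw [mul_assoc]
          gcongr
          calc D ≤ (N + D) * 1 := by linarith
            _ ≤ (N + D) * (1 + ‖a‖) ^ k := by
              gcongr
              exact one_le_pow₀ (by linarith [norm_nonneg a])
        calc ‖e (k + 1) t‖ ≤ (N + D) * (1 + ‖a‖) ^ k * (S₀ * exp (-c' * t))
              + ‖a‖ * ((N + D) * (1 + ‖a‖) ^ k * (S₀ * exp (-c' * t))) := by
              refine h3.trans (add_le_add (h1.trans h4) (by gcongr))
          _ = _ := by ring
    intro k hkn t ht
    refine (hk k hkn t ht).trans ?_
    have : (1 + ‖a‖) ^ k ≤ (1 + ‖a‖) ^ n :=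
      pow_le_pow_right₀ (by linarith [norm_nonneg a]) (by omega)
    calc (N + D) * (1 + ‖a‖) ^ k * (S₀ * exp (-c' * t))
        ≤ (N + D) * (1 + ‖a‖) ^ n * (S₀ * exp (-c' * t)) := by gcongr
      _ = _ := by ring

open Polynomial in
theorem Hurwitz.exists_exponential_bound {k₁ k₂ k₃ k₄ : ℝ} (h : Hurwitz k₁ k₂ k₃ k₄) :
    ∃ C > 0, ∃ c > 0, ∀ (T : ℝ) (e : ℕ → ℝ → ℝ),
      (∀ k < 4, ∀ t ∈ Ico 0 T, HasDerivWithinAt (e k) (e (k + 1) t) (Ici 0) t) →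
      (∀ t ∈ Ico 0 T, e 4 t = -k₁ * e 0 t - k₂ * e 1 t - k₃ * e 2 t - k₄ * e 3 t) →
      ∀ k < 4, ∀ t ∈ Ico 0 T, |e k t| ≤ C * exp (-c * t) * ∑ j ∈ Finset.range 4, |e j 0| := by
  set p : ℂ[X] := X ^ 4 + (C (k₄ : ℂ) * X ^ 3 + C (k₃ : ℂ) * X ^ 2 + C (k₂ : ℂ) * X + C (k₁ : ℂ))
    with hp
  have hlow : (C (k₄ : ℂ) * X ^ 3 + C (k₃ : ℂ) * X ^ 2 + C (k₂ : ℂ) * X + C (k₁ : ℂ)).degree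
      < ((4 : ℕ) : WithBot ℕ) := degree_cubic_le.trans_lt (by norm_num)
  have hm : p.Monic := monic_X_pow_add hlow
  have hd : p.natDegree = 4 := natDegree_eq_of_degree_eq_some (by
    rw [hp, degree_add_eq_left_of_degree_lt (by rwa [degree_X_pow]), degree_X_pow])
  obtain ⟨C, hC, c, hc, H⟩ := Quadrotor.exists_exponential_bound 4 p hm hd fun s hs => h s (by
    simp [hp] at hs
    linear_combination hs)
  refine ⟨C, hC, c, hc, fun T e he hsum k hk t ht => ?_⟩
  have := H T (fun k t => (e k t : ℂ)) (fun k hk t ht => (he k hk t ht).ofReal_comp)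
    (fun t ht => by
      simp [Finset.sum_range_succ, hp, coeff_X, coeff_C, coeff_X_pow, hsum t ht]) k hk t ht
  simpa using this

open Polynomial in
theorem exists_exponential_bound_quadratic {k₁ k₂ : ℝ} (h₁ : 0 < k₁) (h₂ : 0 < k₂) :
    ∃ C > 0, ∃ c > 0, ∀ (T : ℝ) (e : ℕ → ℝ → ℝ),
      (∀ k < 2, ∀ t ∈ Ico 0 T, HasDerivWithinAt (e k) (e (k + 1) t) (Ici 0) t) →
      (∀ t ∈ Ico 0 T, e 2 t = -k₁ * e 0 t - k₂ * e 1 t) →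
      ∀ k < 2, ∀ t ∈ Ico 0 T, |e k t| ≤ C * exp (-c * t) * ∑ j ∈ Finset.range 2, |e j 0| := by
  set p : ℂ[X] := X ^ 2 + (C (k₂ : ℂ) * X + C (k₁ : ℂ)) with hp
  have hlow : (C (k₂ : ℂ) * X + C (k₁ : ℂ)).degree < ((2 : ℕ) : WithBot ℕ) :=
    degree_linear_le.trans_lt (by norm_num)
  have hm : p.Monic := monic_X_pow_add hlow
  have hd : p.natDegree = 2 := natDegree_eq_of_degree_eq_some (by
    rw [hp, degree_add_eq_left_of_degree_lt (by rwa [degree_X_pow]), degree_X_pow])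
  obtain ⟨C, hC, c, hc, H⟩ := Quadrotor.exists_exponential_bound 2 p hm hd fun s hs => by
    simp [hp] at hs
    by_contra! hre
    -- The imaginary part of the equation is `s.im * (2 * s.re + k₂) = 0`. A root with nonnegative
    -- real part is therefore real, which the positive coefficients exclude.
    have hi := congrArg Complex.im hs
    have hr := congrArg Complex.re hs
    simp [pow_two] at hi hr
    have hi0 : s.im = 0 := by
      have : s.im * (2 * s.re + k₂) = 0 := by linarith
      rcases mul_eq_zero.1 this with h | h
      · exact h
      · linarith
    rw [hi0] at hr
    nlinarith [mul_nonneg h₂.le hre]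
  refine ⟨C, hC, c, hc, fun T e he hsum k hk t ht => ?_⟩
  have := H T (fun k t => (e k t : ℂ)) (fun k hk t ht => (he k hk t ht).ofReal_comp)
    (fun t ht => by
      simp [Finset.sum_range_succ, hp, coeff_X, coeff_C, coeff_X_pow, hsum t ht]) k hk t ht
  simpa using this

/-! ### The hyperbolic tangent -/

theorem hasDerivAt_tanh (x : ℝ) : HasDerivAt tanh (1 - tanh x ^ 2) x := by
  have h : HasDerivAt (fun x => sinh x / cosh x)
      ((cosh x * cosh x - sinh x * sinh x) / cosh x ^ 2) x :=
    (hasDerivAt_sinh x).div (hasDerivAt_cosh x) (cosh_pos x).ne'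
  have e : (fun x => sinh x / cosh x) = tanh := by
    funext y
    rw [tanh_eq_sinh_div_cosh]
  rw [e] at h
  refine h.congr_deriv ?_
  have := (cosh_pos x).ne'
  rw [tanh_eq_sinh_div_cosh]
  field_simp

theorem contDiff_tanh {n : WithTop ℕ∞} : ContDiff ℝ n tanh := by
  have e : tanh = fun x => sinh x / cosh x := by
    funext y
    rw [tanh_eq_sinh_div_cosh]
  rw [e]
  exact contDiff_sinh.div contDiff_cosh fun x => (cosh_pos x).ne'

theorem lipschitzWith_tanh : LipschitzWith 1 tanh := by
  refine lipschitzWith_of_nnnorm_deriv_le (fun x => (hasDerivAt_tanh x).differentiableAt)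
    fun x => ?_
  rw [(hasDerivAt_tanh x).deriv, ← NNReal.coe_le_coe, coe_nnnorm, norm_eq_abs, NNReal.coe_one,
    abs_le]
  have := tanh_sq_lt_one x
  constructor <;> nlinarith [sq_nonneg (tanh x)]

theorem abs_tanh_le (x : ℝ) : |tanh x| ≤ |x| := by
  simpa using lipschitzWith_tanh.norm_sub_le x 0

theorem mul_tanh_pos {x : ℝ} (hx : x ≠ 0) : 0 < x * tanh x := by
  rw [tanh_eq_sinh_div_cosh, mul_div_assoc']
  refine div_pos ?_ (cosh_pos x)
  rcases lt_or_gt_of_ne hx with h | h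
  · exact mul_pos_of_neg_of_neg h (sinh_neg_iff.2 h)
  · exact mul_pos h (sinh_pos_iff.2 h)

theorem mul_tanh_nonneg (x : ℝ) : 0 ≤ x * tanh x := by
  rcases eq_or_ne x 0 with h | h
  · simp [h]
  · exact (mul_tanh_pos h).le

theorem hasDerivAt_log_cosh (x : ℝ) : HasDerivAt (fun x => log (cosh x)) (tanh x) x := by
  rw [tanh_eq_sinh_div_cosh]
  exact (hasDerivAt_cosh x).log (cosh_pos x).ne'

theorem log_cosh_nonneg (x : ℝ) : 0 ≤ log (cosh x) := log_nonneg (one_le_cosh x)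

/-- Because `exp |x| ≤ 2 cosh x`. This linear growth makes the sublevel sets of the altitude energy
bounded. -/
theorem abs_le_log_cosh_add (x : ℝ) : |x| ≤ log (cosh x) + log 2 := by
  rw [← log_mul (cosh_pos x).ne' two_ne_zero, ← cosh_abs, le_log_iff_exp_le (by positivity),
    cosh_eq]
  linarith [exp_pos (-|x|)]

theorem abs_lt_of_log_cosh_lt {x r : ℝ} (hr : 0 < r) (h : log (cosh x) < log (cosh r)) :
    |x| < r := by
  rw [log_lt_log_iff (cosh_pos x) (cosh_pos r), cosh_lt_cosh] at h
  rwa [abs_of_pos hr] at h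

/-! ### Altitude -/

/-- The Lyapunov function of `e'' = -k₁ tanh (e' + k₂ e) - k₃ tanh e'`. -/
noncomputable def altitudeEnergy (k₁ k₂ k₃ : ℝ) (s : ℝ × ℝ) : ℝ :=
  k₂ / 2 * s.2 ^ 2 + k₁ * log (cosh (s.2 + k₂ * s.1)) + k₃ * log (cosh s.2)

noncomputable def altitudeAcc (k₁ k₂ k₃ : ℝ) (s : ℝ × ℝ) : ℝ :=
  -k₁ * tanh (s.2 + k₂ * s.1) - k₃ * tanh s.2

/-- The rate at which `altitudeEnergy` decreases. -/
noncomputable def altitudeDissipation (k₁ k₂ k₃ : ℝ) (s : ℝ × ℝ) : ℝ :=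
  altitudeAcc k₁ k₂ k₃ s ^ 2 + k₂ * k₃ * (s.2 * tanh s.2)

structure IsAltitudeError (k₁ k₂ k₃ : ℝ) (e p : ℝ → ℝ) : Prop where
  fst : ∀ t ≥ 0, HasDerivWithinAt e (p t) (Ici 0) t
  snd : ∀ t ≥ 0, HasDerivWithinAt p (altitudeAcc k₁ k₂ k₃ (e t, p t)) (Ici 0) t

theorem continuous_altitudeAcc (k₁ k₂ k₃ : ℝ) : Continuous (altitudeAcc k₁ k₂ k₃) := by
  have := (contDiff_tanh (n := 0)).continuous
  unfold altitudeAcc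
  fun_prop

theorem continuous_altitudeDissipation (k₁ k₂ k₃ : ℝ) :
    Continuous (altitudeDissipation k₁ k₂ k₃) := by
  have := (contDiff_tanh (n := 0)).continuous
  have := continuous_altitudeAcc k₁ k₂ k₃
  unfold altitudeDissipation
  fun_prop

theorem continuous_altitudeEnergy (k₁ k₂ k₃ : ℝ) : Continuous (altitudeEnergy k₁ k₂ k₃) := by
  have : Continuous fun x => log (cosh x) :=
    continuous_iff_continuousAt.2 fun x => (hasDerivAt_log_cosh x).continuousAt
  have h1 := this.comp (by fun_prop : Continuous fun s : ℝ × ℝ => s.2 + k₂ * s.1)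
  have h2 := this.comp (continuous_snd : Continuous fun s : ℝ × ℝ => s.2)
  exact ((by fun_prop : Continuous fun s : ℝ × ℝ => k₂ / 2 * s.2 ^ 2).add
    (h1.const_mul k₁)).add (h2.const_mul k₃)

theorem le_sub_mul_of_hasDerivWithinAt {f f' : ℝ → ℝ} {w t : ℝ} (ht : 0 ≤ t)
    (hf : ∀ s ≥ 0, HasDerivWithinAt f (f' s) (Ici 0) s) (hw : ∀ s ∈ Icc 0 t, f' s ≤ -w) :
    f t ≤ f 0 - w * t := by
  have := image_le_of_deriv_right_le_deriv_boundary (a := 0) (b := t) (f := f) (f' := f')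
    (B := fun s => f 0 - w * s) (B' := fun _ => -w)
    (fun s hs => (hf s hs.1).continuousWithinAt.mono Icc_subset_Ici_self)
    (fun s hs => (hf s hs.1).mono (Ici_subset_Ici.2 hs.1)) (by simp)
    (by fun_prop)
    (fun s _ => by
      simpa using (((hasDerivAt_id s).const_mul w).const_sub (f 0)).hasDerivWithinAt)
    (fun s hs => hw s ⟨hs.1, hs.2.le⟩) (right_mem_Icc.2 ht)
  exact this

section

variable {k₁ k₂ k₃ : ℝ}

theorem altitudeEnergy_nonneg (h₁ : 0 < k₁) (h₂ : 0 < k₂) (h₃ : 0 < k₃) (s : ℝ × ℝ) :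
    0 ≤ altitudeEnergy k₁ k₂ k₃ s := by
  have := log_cosh_nonneg (s.2 + k₂ * s.1)
  have := log_cosh_nonneg s.2
  unfold altitudeEnergy
  positivity

theorem mul_log_cosh_le_altitudeEnergy (h₁ : 0 < k₁) (h₂ : 0 < k₂) (h₃ : 0 < k₃) (s : ℝ × ℝ) :
    k₁ * log (cosh (s.2 + k₂ * s.1)) ≤ altitudeEnergy k₁ k₂ k₃ s ∧
      k₃ * log (cosh s.2) ≤ altitudeEnergy k₁ k₂ k₃ s := by
  have h4 : 0 ≤ k₁ * log (cosh (s.2 + k₂ * s.1)) := mul_nonneg h₁.le (log_cosh_nonneg _)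
  have h5 : 0 ≤ k₃ * log (cosh s.2) := mul_nonneg h₃.le (log_cosh_nonneg _)
  have h6 : 0 ≤ k₂ / 2 * s.2 ^ 2 := by positivity
  unfold altitudeEnergy
  constructor <;> linarith

theorem altitudeDissipation_nonneg (h₂ : 0 < k₂) (h₃ : 0 < k₃) (s : ℝ × ℝ) :
    0 ≤ altitudeDissipation k₁ k₂ k₃ s := by
  have := mul_tanh_nonneg s.2
  unfold altitudeDissipation
  positivity

/-- At rest away from the origin the acceleration `-k₁ tanh (k₂ e)` is nonzero. The squared
acceleration thus makes the Lyapunov function strict, and no invariance principle is needed. -/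
theorem altitudeDissipation_pos (h₁ : 0 < k₁) (h₂ : 0 < k₂) (h₃ : 0 < k₃) {s : ℝ × ℝ}
    (hs : s ≠ 0) : 0 < altitudeDissipation k₁ k₂ k₃ s := by
  obtain ⟨e, p⟩ := s
  rcases eq_or_ne p 0 with hp | hp
  · subst hp
    have he : e ≠ 0 := fun h => hs (by rw [h]; rfl)
    have h1 := mul_tanh_pos (mul_ne_zero h₂.ne' he)
    have h2 : tanh (k₂ * e) ≠ 0 := fun h => by simp [h] at h1
    simp only [altitudeDissipation, altitudeAcc, tanh_zero, mul_zero, sub_zero, zero_add, add_zero]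
    have := mul_ne_zero (neg_ne_zero.2 h₁.ne') h2
    positivity
  · have := mul_tanh_pos hp
    unfold altitudeDissipation
    positivity

theorem isCompact_altitudeEnergy_le (h₁ : 0 < k₁) (h₂ : 0 < k₂) (h₃ : 0 < k₃) (c : ℝ) :
    IsCompact {s | altitudeEnergy k₁ k₂ k₃ s ≤ c} := by
  refine Metric.isCompact_of_isClosed_isBounded
    (isClosed_le (continuous_altitudeEnergy k₁ k₂ k₃) continuous_const) ?_
  set P := c / k₃ + log 2
  set Q := c / k₁ + log 2
  refine (Metric.isBounded_Icc (α := ℝ) (-((P + Q) / k₂)) ((P + Q) / k₂)).prod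
    (Metric.isBounded_Icc (α := ℝ) (-P) P) |>.subset fun s hs => ?_
  obtain ⟨h4, h5⟩ := mul_log_cosh_le_altitudeEnergy h₁ h₂ h₃ s
  have hp : |s.2| ≤ P := by
    have : log (cosh s.2) ≤ c / k₃ := by
      rw [le_div_iff₀ h₃]
      linarith [hs.out]
    linarith [abs_le_log_cosh_add s.2]
  have hq : |s.2 + k₂ * s.1| ≤ Q := by
    have : log (cosh (s.2 + k₂ * s.1)) ≤ c / k₁ := by
      rw [le_div_iff₀ h₁]
      linarith [hs.out]
    linarith [abs_le_log_cosh_add (s.2 + k₂ * s.1)]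
  have he : |s.1| ≤ (P + Q) / k₂ := by
    rw [le_div_iff₀ h₂]
    calc |s.1| * k₂ = |s.1 * k₂| := by rw [abs_mul, abs_of_pos h₂]
      _ = |(s.2 + k₂ * s.1) - s.2| := by ring_nf
      _ ≤ |s.2 + k₂ * s.1| + |s.2| := abs_sub _ _
      _ ≤ P + Q := by linarith
  exact ⟨abs_le.1 he, abs_le.1 hp⟩

theorem exists_altitudeEnergy_lt_imp (h₁ : 0 < k₁) (h₂ : 0 < k₂) (h₃ : 0 < k₃) {ε : ℝ}
    (hε : 0 < ε) : ∃ η > 0, ∀ s, altitudeEnergy k₁ k₂ k₃ s < η →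
      |s.1| < ε ∧ |s.2| < ε ∧ |altitudeAcc k₁ k₂ k₃ s| < ε := by
  -- Once `|p|` and `|p + k₂ e|` are below `r`, the three entries give the bounds on `p`, on `e` (as
  -- `k₂ |e| < 2 r`), and on the acceleration (as `|tanh x| ≤ |x|`).
  set r := min ε (min (ε * k₂ / 2) (ε / (k₁ + k₃))) with hr
  have hr0 : 0 < r := by positivity
  have hr1 : r ≤ ε := min_le_left _ _
  have hr2 : r ≤ ε * k₂ / 2 := (min_le_right _ _).trans (min_le_left _ _)
  have hr3 : r ≤ ε / (k₁ + k₃) := (min_le_right _ _).trans (min_le_right _ _)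
  have hl : 0 < log (cosh r) := log_pos (one_lt_cosh.2 hr0.ne')
  refine ⟨min k₁ k₃ * log (cosh r), by positivity, fun s hs => ?_⟩
  obtain ⟨h4, h5⟩ := mul_log_cosh_le_altitudeEnergy h₁ h₂ h₃ s
  have hp : |s.2| < r := by
    refine abs_lt_of_log_cosh_lt hr0 (lt_of_mul_lt_mul_left (a := k₃) ?_ h₃.le)
    refine (h5.trans_lt hs).trans_le ?_
    gcongr
    exact min_le_right _ _
  have hq : |s.2 + k₂ * s.1| < r := by
    refine abs_lt_of_log_cosh_lt hr0 (lt_of_mul_lt_mul_left (a := k₁) ?_ h₁.le)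
    refine (h4.trans_lt hs).trans_le ?_
    gcongr
    exact min_le_left _ _
  refine ⟨?_, hp.trans_le hr1, ?_⟩
  · have : |s.1| * k₂ < ε * k₂ := by
      calc |s.1| * k₂ = |s.1 * k₂| := by rw [abs_mul, abs_of_pos h₂]
        _ = |(s.2 + k₂ * s.1) - s.2| := by ring_nf
        _ ≤ |s.2 + k₂ * s.1| + |s.2| := abs_sub _ _
        _ < ε * k₂ := by linarith
    exact lt_of_mul_lt_mul_right this h₂.le
  · calc |altitudeAcc k₁ k₂ k₃ s|
        ≤ |-k₁ * tanh (s.2 + k₂ * s.1)| + |k₃ * tanh s.2| := abs_sub _ _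
      _ = k₁ * |tanh (s.2 + k₂ * s.1)| + k₃ * |tanh s.2| := by
          rw [abs_mul, abs_mul, abs_neg, abs_of_pos h₁, abs_of_pos h₃]
      _ ≤ k₁ * |s.2 + k₂ * s.1| + k₃ * |s.2| := by
          exact add_le_add (mul_le_mul_of_nonneg_left (abs_tanh_le _) h₁.le)
            (mul_le_mul_of_nonneg_left (abs_tanh_le _) h₃.le)
      _ < k₁ * r + k₃ * r := by gcongr
      _ = r * (k₁ + k₃) := by ring
      _ ≤ ε := by rwa [← le_div_iff₀ (by positivity)]

/-- With `q = p + k₂ e`, the derivative regroups as `p' (k₁ tanh q + k₃ tanh p) + k₂ p (p' + k₁ tanh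
q)`. By the equation the brackets are `-p'` and `-k₃ tanh p`. -/
theorem IsAltitudeError.hasDerivWithinAt_energy {e p : ℝ → ℝ}
    (h : IsAltitudeError k₁ k₂ k₃ e p) {t : ℝ} (ht : 0 ≤ t) :
    HasDerivWithinAt (fun t => altitudeEnergy k₁ k₂ k₃ (e t, p t))
      (-altitudeDissipation k₁ k₂ k₃ (e t, p t)) (Ici 0) t := by
  have he := h.fst t ht
  have hp := h.snd t ht
  have h1 := (hp.pow 2).const_mul (k₂ / 2)
  have h2 := ((hasDerivAt_log_cosh _).comp_hasDerivWithinAt t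
    (hp.add (he.const_mul k₂))).const_mul k₁
  have h3 := ((hasDerivAt_log_cosh _).comp_hasDerivWithinAt t hp).const_mul k₃
  refine ((h1.add h2).add h3).congr_deriv ?_
  simp only [altitudeDissipation, altitudeAcc, Pi.add_apply]
  push_cast
  ring

theorem IsAltitudeError.energy_le {e p : ℝ → ℝ} (h : IsAltitudeError k₁ k₂ k₃ e p)
    (h₂ : 0 < k₂) (h₃ : 0 < k₃) {t : ℝ} (ht : 0 ≤ t) :
    altitudeEnergy k₁ k₂ k₃ (e t, p t) ≤ altitudeEnergy k₁ k₂ k₃ (e 0, p 0) := by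
  have := le_sub_mul_of_hasDerivWithinAt (w := 0) ht (fun s hs => h.hasDerivWithinAt_energy hs)
    (fun s _ => by simpa using altitudeDissipation_nonneg h₂ h₃ _)
  simpa using this

theorem altitudeError_stable (h₁ : 0 < k₁) (h₂ : 0 < k₂) (h₃ : 0 < k₃) {ε : ℝ} (hε : 0 < ε) :
    ∃ δ > 0, ∀ e p, IsAltitudeError k₁ k₂ k₃ e p → |e 0| < δ → |p 0| < δ → ∀ t ≥ 0,
      |e t| < ε ∧ |p t| < ε ∧ |altitudeAcc k₁ k₂ k₃ (e t, p t)| < ε := by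
  obtain ⟨η, hη, H⟩ := exists_altitudeEnergy_lt_imp h₁ h₂ h₃ hε
  have h0 : altitudeEnergy k₁ k₂ k₃ 0 < η := by simpa [altitudeEnergy] using hη
  obtain ⟨δ, hδ, hball⟩ := Metric.mem_nhds_iff.1
    ((continuous_altitudeEnergy k₁ k₂ k₃).continuousAt.eventually_lt continuousAt_const h0)
  refine ⟨δ, hδ, fun e p h he hp t ht => H _ ((h.energy_le h₂ h₃ ht).trans_lt (hball ?_))⟩
  simp [he, hp]

/-- On the compact shell `η ≤ energy ≤ c` the dissipation has a positive minimum `w`, so the energy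
must drop below `η` within a time determined by `c` and `w`, and it never increases again. -/
theorem altitudeError_attractive (h₁ : 0 < k₁) (h₂ : 0 < k₂) (h₃ : 0 < k₃) (ρ : ℝ) {ε : ℝ}
    (hε : 0 < ε) :
    ∃ T ≥ 0, ∀ e p, IsAltitudeError k₁ k₂ k₃ e p → |e 0| < ρ → |p 0| < ρ → ∀ t ≥ T,
      |e t| < ε ∧ |p t| < ε ∧ |altitudeAcc k₁ k₂ k₃ (e t, p t)| < ε := by
  obtain ⟨η, hη, H⟩ := exists_altitudeEnergy_lt_imp h₁ h₂ h₃ hε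
  obtain ⟨c, hc⟩ := ((isCompact_closedBall (0 : ℝ × ℝ) ρ).image
    (continuous_altitudeEnergy k₁ k₂ k₃)).bddAbove
  have hA : IsCompact ({s | altitudeEnergy k₁ k₂ k₃ s ≤ c} ∩ {s | η ≤ altitudeEnergy k₁ k₂ k₃ s}) :=
    (isCompact_altitudeEnergy_le h₁ h₂ h₃ c).inter_right
      (isClosed_le continuous_const (continuous_altitudeEnergy k₁ k₂ k₃))
  obtain ⟨w, hw, hwle⟩ : ∃ w > 0, ∀ s, altitudeEnergy k₁ k₂ k₃ s ≤ c →
      η ≤ altitudeEnergy k₁ k₂ k₃ s → w ≤ altitudeDissipation k₁ k₂ k₃ s := by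
    obtain ⟨w, hw, hwle⟩ := hA.exists_forall_le' (a := 0)
      (continuous_altitudeDissipation k₁ k₂ k₃).continuousOn fun s hs =>
        altitudeDissipation_pos h₁ h₂ h₃ (s := s) fun h => by
          have := hs.2.out
          rw [h] at this
          simp [altitudeEnergy] at this
          linarith
    exact ⟨w, hw, fun s h h' => hwle s ⟨h, h'⟩⟩
  -- Losing energy at rate `w` for this long would make the energy negative.
  refine ⟨|c| / w + 1, by positivity, fun e p h he hp t ht => H (e t, p t) ?_⟩
  have ht0 : 0 ≤ t := le_trans (by positivity) ht
  have hc0 : altitudeEnergy k₁ k₂ k₃ (e 0, p 0) ≤ c := hc ⟨(e 0, p 0), by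
    simp [Prod.norm_def, he.le, hp.le], rfl⟩
  by_contra! hlt
  have hdec : ∀ s ∈ Icc 0 t, η ≤ altitudeEnergy k₁ k₂ k₃ (e s, p s) := by
    intro s hs
    refine hlt.trans ?_
    -- The equation is autonomous, so the time shift is again a solution and the energy at `t` is at
    -- most that at `s`.
    have h' : IsAltitudeError k₁ k₂ k₃ (fun r => e (s + r)) (fun r => p (s + r)) := by
      have hs' : MapsTo (fun r => s + r) (Ici 0) (Ici (0 : ℝ)) := fun r hr =>
        add_nonneg hs.1 hr
      have hd : ∀ r : ℝ, HasDerivWithinAt (fun r => s + r) 1 (Ici 0) r := fun r =>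
        ((hasDerivAt_id r).const_add s).hasDerivWithinAt
      exact ⟨fun r hr =>
          ((h.fst (s + r) (add_nonneg hs.1 hr)).comp r (hd r) hs').congr_deriv (mul_one _),
        fun r hr =>
          ((h.snd (s + r) (add_nonneg hs.1 hr)).comp r (hd r) hs').congr_deriv (mul_one _)⟩
    simpa using h'.energy_le h₂ h₃ (t := t - s) (by linarith [hs.2])
  have := le_sub_mul_of_hasDerivWithinAt (w := w) ht0 (fun s hs => h.hasDerivWithinAt_energy hs)
    (fun s hs => neg_le_neg (hwle _ ((h.energy_le h₂ h₃ hs.1).trans hc0) (hdec s hs)))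
  have h6 : |c| + w ≤ w * t := by
    calc |c| + w = w * (|c| / w + 1) := by field_simp
      _ ≤ w * t := by gcongr
  linarith [le_abs_self c, altitudeEnergy_nonneg h₁ h₂ h₃ (e t, p t)]

end

/-! ### Entrywise derivatives of matrices and vectors -/

section

variable {ι : Type*} {s : Set ℝ} {t : ℝ}

/-- The vector-valued function `v` has the derivative `v'` within `s`, entry by entry. -/
def HasVecDeriv (v : ℝ → ι → ℝ) (v' : ι → ℝ) (s : Set ℝ) (t : ℝ) : Prop :=
  ∀ i, HasDerivWithinAt (fun r => v r i) (v' i) s t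

/-- The matrix-valued function `A` has the derivative `A'` within `s`, entry by entry. -/
def HasMatDeriv (A : ℝ → Matrix ι ι ℝ) (A' : Matrix ι ι ℝ) (s : Set ℝ) (t : ℝ) : Prop :=
  ∀ i j, HasDerivWithinAt (fun r => A r i j) (A' i j) s t

theorem HasVecDeriv.congr_deriv {v : ℝ → ι → ℝ} {v' w' : ι → ℝ} (hv : HasVecDeriv v v' s t)
    (h : v' = w') : HasVecDeriv v w' s t := h ▸ hv

theorem HasMatDeriv.congr_deriv {A : ℝ → Matrix ι ι ℝ} {A' B' : Matrix ι ι ℝ}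
    (hA : HasMatDeriv A A' s t) (h : A' = B') : HasMatDeriv A B' s t := h ▸ hA

theorem HasVecDeriv.add {v w : ℝ → ι → ℝ} {v' w' : ι → ℝ} (hv : HasVecDeriv v v' s t)
    (hw : HasVecDeriv w w' s t) : HasVecDeriv (fun r => v r + w r) (v' + w') s t :=
  fun i => (hv i).add (hw i)

theorem HasVecDeriv.sub {v w : ℝ → ι → ℝ} {v' w' : ι → ℝ} (hv : HasVecDeriv v v' s t)
    (hw : HasVecDeriv w w' s t) : HasVecDeriv (fun r => v r - w r) (v' - w') s t :=
  fun i => (hv i).sub (hw i)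

theorem HasMatDeriv.add {A B : ℝ → Matrix ι ι ℝ} {A' B' : Matrix ι ι ℝ}
    (hA : HasMatDeriv A A' s t) (hB : HasMatDeriv B B' s t) :
    HasMatDeriv (fun r => A r + B r) (A' + B') s t :=
  fun i j => (hA i j).add (hB i j)

theorem HasMatDeriv.smul {u : ℝ → ℝ} {u' : ℝ} {A : ℝ → Matrix ι ι ℝ} {A' : Matrix ι ι ℝ}
    (hu : HasDerivWithinAt u u' s t) (hA : HasMatDeriv A A' s t) :
    HasMatDeriv (fun r => u r • A r) (u' • A t + u t • A') s t :=
  fun i j => hu.mul (hA i j)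

variable [Fintype ι]

theorem HasMatDeriv.mul {A B : ℝ → Matrix ι ι ℝ} {A' B' : Matrix ι ι ℝ}
    (hA : HasMatDeriv A A' s t) (hB : HasMatDeriv B B' s t) :
    HasMatDeriv (fun r => A r * B r) (A' * B t + A t * B') s t := by
  intro i j
  simp only [mul_apply, Matrix.add_apply, ← Finset.sum_add_distrib]
  exact HasDerivWithinAt.fun_sum fun k _ => (hA i k).mul (hB k j)

theorem HasMatDeriv.mul_const {A : ℝ → Matrix ι ι ℝ} {A' : Matrix ι ι ℝ}
    (hA : HasMatDeriv A A' s t) (B : Matrix ι ι ℝ) :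
    HasMatDeriv (fun r => A r * B) (A' * B) s t := by
  intro i j
  simp only [mul_apply]
  exact HasDerivWithinAt.fun_sum fun k _ => (hA i k).mul_const (B k j)

theorem HasMatDeriv.mulVec {A : ℝ → Matrix ι ι ℝ} {A' : Matrix ι ι ℝ} {v : ℝ → ι → ℝ}
    {v' : ι → ℝ} (hA : HasMatDeriv A A' s t) (hv : HasVecDeriv v v' s t) :
    HasVecDeriv (fun r => A r *ᵥ v r) (A' *ᵥ v t + A t *ᵥ v') s t := by
  intro i
  simp only [Matrix.mulVec, dotProduct, Pi.add_apply, ← Finset.sum_add_distrib]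
  exact HasDerivWithinAt.fun_sum fun k _ => (hA i k).mul (hv k)

end

/-! ### The feedback quantities along a motion -/

/-- At time `t`, altitude error and yaw obey the closed-loop equations, and the attitude is
nonsingular. -/
structure RegularAt (K : Gains) (r : Reference) (d : Offset) (q : Trajectory) (t : ℝ) : Prop where
  z0 : HasDerivWithinAt (errZ r d q) (der 1 (errZ r d q) t) (Ici 0) t
  z1 : HasDerivWithinAt (der 1 (errZ r d q)) (accZ K r d q t) (Ici 0) t
  ψ0 : HasDerivWithinAt q.ψ (der 1 q.ψ t) (Ici 0) t
  ψ1 : HasDerivWithinAt (der 1 q.ψ) (yawInput K q t) (Ici 0) t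
  φ0 : HasDerivWithinAt q.φ (der 1 q.φ t) (Ici 0) t
  θ0 : HasDerivWithinAt q.θ (der 1 q.θ t) (Ici 0) t
  cosφ : cos (q.φ t) ≠ 0
  cosθ : cos (q.θ t) ≠ 0

section

variable {g : ℝ} {K : Gains} {r : Reference} {d : Offset} {q : Trajectory} {t : ℝ}

theorem hasDerivWithinAt_tanh_comp {f : ℝ → ℝ} {f' : ℝ} {s : Set ℝ} (hf : HasDerivWithinAt f f' s t) :
    HasDerivWithinAt (fun r => tanh (f r)) ((1 - tanh (f t) ^ 2) * f') s t :=
  (hasDerivAt_tanh _).comp_hasDerivWithinAt t hf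

theorem hasDerivWithinAt_ubar (h : RegularAt K r d q t) (hr : TimesDiff 4 r.z) (ht : 0 ≤ t) :
    HasDerivWithinAt (ubar g K r d q) (ubarD K r d q t) (Ici 0) t := by
  have h1 := hasDerivWithinAt_tanh_comp (h.z1.add (h.z0.const_mul K.k2z))
  have h2 := hasDerivWithinAt_tanh_comp h.z1
  refine ((((hr.hasDerivWithinAt (by norm_num : 2 < 4) ht).const_add g).sub
    (h1.const_mul K.k1z)).sub (h2.const_mul K.k3z)).congr_deriv ?_
  simp only [ubarD, Pi.add_apply]
  ring

theorem hasDerivWithinAt_accZ (h : RegularAt K r d q t) :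
    HasDerivWithinAt (accZ K r d q) (jerkZ K r d q t) (Ici 0) t := by
  have h1 := hasDerivWithinAt_tanh_comp (h.z1.add (h.z0.const_mul K.k2z))
  have h2 := hasDerivWithinAt_tanh_comp h.z1
  refine ((h1.const_mul (-K.k1z)).sub (h2.const_mul K.k3z)).congr_deriv ?_
  simp only [jerkZ, Pi.add_apply]
  ring

theorem hasDerivWithinAt_ubarD (h : RegularAt K r d q t) (hr : TimesDiff 4 r.z) (ht : 0 ≤ t) :
    HasDerivWithinAt (ubarD K r d q) (ubarDD K r d q t) (Ici 0) t := by
  have h1 := hasDerivWithinAt_tanh_comp (h.z1.add (h.z0.const_mul K.k2z))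
  have h2 := hasDerivWithinAt_tanh_comp h.z1
  have h3 := hasDerivWithinAt_accZ h
  have h4 := ((h2.pow 2).const_sub 1).const_mul K.k3z |>.mul h3
  have h5 := ((h1.pow 2).const_sub 1).const_mul K.k1z |>.mul (h3.add (h.z1.const_mul K.k2z))
  refine (((hr.hasDerivWithinAt (by norm_num : 3 < 4) ht).sub h4).sub h5).congr_deriv ?_
  simp only [ubarDD, Pi.add_apply, Pi.pow_apply]
  push_cast
  ring

theorem hasMatDeriv_R2 (h : RegularAt K r d q t) :
    HasMatDeriv (fun t => R2 (q.ψ t)) (R2D q t) (Ici 0) t := by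
  have hc := h.ψ0.cos
  have hs := h.ψ0.sin
  intro i j
  fin_cases i <;> fin_cases j <;> simp [R2, R2D]
  · exact hc.congr_deriv (by ring)
  · exact hs.neg.congr_deriv (by ring)
  · exact hs.congr_deriv (by ring)
  · exact hc.congr_deriv (by ring)

theorem HasMatDeriv.const_mul {ι : Type*} [Fintype ι] {s : Set ℝ} {A : ℝ → Matrix ι ι ℝ}
    {A' : Matrix ι ι ℝ} (hA : HasMatDeriv A A' s t) (B : Matrix ι ι ℝ) :
    HasMatDeriv (fun r => B * A r) (B * A') s t := by
  intro i j
  simp only [mul_apply]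
  exact HasDerivWithinAt.fun_sum fun k _ => (hA k j).const_mul (B i k)

theorem hasMatDeriv_R2D (h : RegularAt K r d q t) :
    HasMatDeriv (R2D q) (R2DD K q t) (Ici 0) t := by
  refine (HasMatDeriv.smul h.ψ1 ((hasMatDeriv_R2 h).const_mul (R2 (π / 2)))).congr_deriv ?_
  simp only [R2DD, R2D, Matrix.mul_smul, smul_smul, pow_two, Matrix.mul_assoc]

theorem hasDerivWithinAt_tan_comp {f : ℝ → ℝ} {f' : ℝ} {s : Set ℝ} (hf : HasDerivWithinAt f f' s t)
    (hc : cos (f t) ≠ 0) :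
    HasDerivWithinAt (fun r => tan (f r)) (1 / cos (f t) ^ 2 * f') s t :=
  (hasDerivAt_tan hc).comp_hasDerivWithinAt t hf

theorem hasVecDeriv_tilt (h : RegularAt K r d q t) :
    HasVecDeriv (tilt q) (Mt q t *ᵥ rates q t) (Ici 0) t := by
  have hc := h.cosθ
  have h1 := hasDerivWithinAt_tan_comp h.θ0 h.cosθ
  have h2 := (hasDerivWithinAt_tan_comp h.φ0 h.cosφ).div h.θ0.cos h.cosθ
  intro i
  fin_cases i <;> simp [tilt, Mt, M, rates]
  · exact h1.congr_deriv (by ring)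
  · refine h2.congr_deriv ?_
    rw [tan_eq_sin_div_cos (q.θ t)]
    field_simp
    ring

theorem hasMatDeriv_Mt (h : RegularAt K r d q t) :
    HasMatDeriv (Mt q) (MtD q t) (Ici 0) t := by
  have hc := h.cosθ
  have hc' := h.cosφ
  have h1 := hasDerivWithinAt_tan_comp h.θ0 h.cosθ
  have h2 := hasDerivWithinAt_tan_comp h.φ0 h.cosφ
  have h3 := h.θ0.cos.inv h.cosθ
  have h4 := h.φ0.cos.inv h.cosφ
  intro i j
  fin_cases i <;> fin_cases j <;> simp [Mt, MtD, M, MD]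
  · exact hasDerivWithinAt_const _ _ _
  · have := h3.pow 2
    simp only [Pi.pow_def, Pi.inv_def, inv_pow] at this
    refine this.congr_deriv ?_
    rw [tan_eq_sin_div_cos (q.θ t)]
    push_cast
    field_simp
  · have := (h4.pow 2).mul h3
    simp only [Pi.pow_def, Pi.mul_def, Pi.inv_def, inv_pow] at this
    refine this.congr_deriv ?_
    rw [tan_eq_sin_div_cos (q.θ t), tan_eq_sin_div_cos (q.φ t)]
    push_cast
    field_simp
  · have := (h2.mul h1).mul h3
    simp only [Pi.mul_def, Pi.inv_def] at this
    refine this.congr_deriv ?_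
    simp only [tan_eq_sin_div_cos (q.θ t), tan_eq_sin_div_cos (q.φ t)]
    field_simp
    ring

theorem hasVecDeriv_thrust (h : RegularAt K r d q t) (hr : TimesDiff 4 r.z) (ht : 0 ≤ t) :
    HasVecDeriv (fun t => (ubar g K r d q t • (R2 (q.ψ t) * S)) *ᵥ tilt q t)
      (Xi1 g K r d q t + (ubar g K r d q t • (R2 (q.ψ t) * S * Mt q t)) *ᵥ rates q t) (Ici 0) t := by
  refine HasVecDeriv.congr_deriv ((HasMatDeriv.smul (hasDerivWithinAt_ubar (g := g) h hr ht)
    ((hasMatDeriv_R2 h).mul_const S)).mulVec (hasVecDeriv_tilt h)) ?_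
  simp only [Xi1, Matrix.add_mul, Matrix.smul_mul, mulVec_mulVec]

theorem hasVecDeriv_Xi1 (h : RegularAt K r d q t) (hr : TimesDiff 4 r.z) (ht : 0 ≤ t) :
    HasVecDeriv (Xi1 g K r d q) (Xi1D g K r d q t) (Ici 0) t := by
  refine HasVecDeriv.congr_deriv ((((HasMatDeriv.smul (hasDerivWithinAt_ubarD h hr ht) (hasMatDeriv_R2 h)).add
    (HasMatDeriv.smul (hasDerivWithinAt_ubar (g := g) h hr ht) (hasMatDeriv_R2D h))).mul_const
      S).mulVec (hasVecDeriv_tilt h)) ?_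
  simp only [Xi1D, mulVec_mulVec]
  congr 3
  module

/-- The angular acceleration is a free vector `a`, because the formula serves twice: for motions
where `a` is the input, and for the constructed motion, where `a` is still to be identified. -/
theorem hasVecDeriv_jerk (h : RegularAt K r d q t) (hr : TimesDiff 4 r.z) (ht : 0 ≤ t)
    {a : Fin 2 → ℝ} (ha : HasVecDeriv (rates q) a (Ici 0) t) :
    HasVecDeriv
      (fun t => Xi1 g K r d q t + (ubar g K r d q t • (R2 (q.ψ t) * S * Mt q t)) *ᵥ rates q t)
      (Xi2 g K r d q t + (ubar g K r d q t • (R2 (q.ψ t) * S * Mt q t)) *ᵥ a) (Ici 0) t := by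
  refine HasVecDeriv.congr_deriv ((hasVecDeriv_Xi1 (g := g) h hr ht).add
    ((HasMatDeriv.smul (hasDerivWithinAt_ubar (g := g) h hr ht)
      (((hasMatDeriv_R2 h).mul_const S).mul (hasMatDeriv_Mt h))).mulVec ha)) ?_
  simp only [Xi2, smul_add, add_assoc]

end

/-! ### Differences of signals -/

section

variable {f h : ℝ → ℝ} {c : ℝ}

theorem timesDiff_sub_sub_const {n : ℕ} (hf : TimesDiff n f) (hh : TimesDiff n h) :
    TimesDiff n (fun t => f t - h t - c) ∧
      ∀ k ∈ Icc 1 n, ∀ t ≥ 0, der k (fun t => f t - h t - c) t = der k f t - der k h t := by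
  let F : ℕ → ℝ → ℝ := fun k t => der k f t - der k h t - if k = 0 then c else 0
  have hF : ∀ k < n, ∀ t ≥ 0, HasDerivWithinAt (F k) (F (k + 1) t) (Ici 0) t := by
    intro k hk t ht
    refine (((hf.hasDerivWithinAt hk ht).sub (hh.hasDerivWithinAt hk ht)).sub_const _).congr_deriv ?_
    simp [F]
  have h0 : F 0 = fun t => f t - h t - c := by
    funext t
    simp [F, der_zero]
  rw [← h0]
  refine ⟨timesDiff_of_chain hF, fun k hk t ht => ?_⟩
  rw [eqOn_der_of_chain hF k hk.2 ht]
  have : k ≠ 0 := by have := hk.1; omega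
  simp [F, this]

theorem TimesDiff.mono {m n : ℕ} (hf : TimesDiff n f) (hmn : m ≤ n) : TimesDiff m f :=
  fun k hk => hf k (hk.trans_le hmn)

end

/-! ### Inverting the attitude dynamics -/

theorem isUnit_det_R2 (a : ℝ) : IsUnit (R2 a).det := by
  have : (R2 a).det = 1 := by
    rw [R2, det_fin_two_of]
    linarith [sin_sq_add_cos_sq a]
  simp [this]

theorem isUnit_det_S : IsUnit S.det := by
  rw [S, det_fin_two_of]
  simp

theorem isUnit_det_M {φ θ : ℝ} (hφ : cos φ ≠ 0) (hθ : cos θ ≠ 0) : IsUnit (M φ θ).det := by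
  rw [M, det_fin_two_of, isUnit_iff_ne_zero]
  simp [hφ, hθ]

/-- All three factors are invertible, `M` because its determinant is `-1 / (cos φ ^ 2 * cos θ ^ 3)`.
One direction shows what the torque law achieves; the other shows that angular accelerations, or
angular rates, are determined by their effect. -/
theorem thrust_mulVec_eq_iff {φ θ a u : ℝ} (hφ : cos φ ≠ 0) (hθ : cos θ ≠ 0) (hu : u ≠ 0)
    (v w : Fin 2 → ℝ) :
    (u • (R2 a * S * M φ θ)) *ᵥ v = w ↔
      v = (1 / u) • (((M φ θ)⁻¹ * S⁻¹ * (R2 a)⁻¹) *ᵥ w) := by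
  have hM := isUnit_det_M hφ hθ
  have hS := isUnit_det_S
  have hR := isUnit_det_R2 a
  have e1 : (M φ θ)⁻¹ * S⁻¹ * (R2 a)⁻¹ = (R2 a * S * M φ θ)⁻¹ := by
    rw [Matrix.mul_inv_rev, Matrix.mul_inv_rev, Matrix.mul_assoc]
  have hA : IsUnit (R2 a * S * M φ θ).det := by
    rw [det_mul, det_mul]
    exact (hR.mul hS).mul hM
  rw [e1]
  constructor
  · rintro rfl
    rw [smul_mulVec, mulVec_smul, mulVec_mulVec, nonsing_inv_mul _ hA, one_mulVec, smul_smul,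
      one_div_mul_cancel hu, one_smul]
  · rintro rfl
    rw [smul_mulVec, mulVec_smul, mulVec_mulVec, mul_nonsing_inv _ hA, one_mulVec, smul_smul,
      mul_one_div_cancel hu, one_smul]

/-! ### Positivity of the thrust and the horizontal error equations -/

section

variable {g : ℝ} {K : Gains} {r : Reference} {d : Offset} {q : Trajectory} {t : ℝ}

/-- Since `|tanh| < 1`. The bound does not involve the state, so compactness in time alone makes it
uniform on bounded intervals. -/
theorem le_ubar (hK : K.Admissible) :
    g - |der 2 r.z t| - K.k1z - K.k3z ≤ ubar g K r d q t := by
  have h1 := abs_lt.1 (abs_tanh_lt_one (der 1 (errZ r d q) t + K.k2z * errZ r d q t))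
  have h2 := abs_lt.1 (abs_tanh_lt_one (der 1 (errZ r d q) t))
  have h3 := neg_abs_le (der 2 r.z t)
  have h4 := hK.k1z_pos
  have h5 := hK.k3z_pos
  unfold ubar
  nlinarith

theorem ubar_pos (hK : K.Admissible) (hr : ThrustBound g K r) (ht : 0 ≤ t) :
    0 < ubar g K r d q t := by
  have := hr t ht
  exact lt_of_lt_of_le (by linarith) (le_ubar hK)

/-- Roll and pitch lie in `(-π/2, π/2)` at time `t`. -/
def Upright (q : Trajectory) (t : ℝ) : Prop :=
  q.φ t ∈ Ioo (-(π / 2)) (π / 2) ∧ q.θ t ∈ Ioo (-(π / 2)) (π / 2)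

/-- The errors in one horizontal direction and their first four derivatives in closed loop, as
functions of the state. -/
noncomputable def errorChain (g : ℝ) (K : Gains) (r : Reference) (d : Offset) (q : Trajectory)
    (e : ℝ → ℝ) (i : Fin 2) : ℕ → ℝ → ℝ
  | 0 => e
  | 1 => der 1 e
  | 2 => fun t => accXY g K r d q t i
  | 3 => fun t => jerkXY g K r d q t i
  | _ => fun t => linearInput g K r d q t i

theorem Tracks.regularAt (h : Tracks g K r d q) (ht : 0 ≤ t) (hq : Upright q t) :
    RegularAt K r d q t := by
  have hφ := (cos_pos_of_mem_Ioo hq.1).ne'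
  have hθ := (cos_pos_of_mem_Ioo hq.2).ne'
  have hz : TimesDiff 2 r.z := h.ref.smooth_z.1.mono (by norm_num)
  obtain ⟨h1, h2⟩ := timesDiff_sub_sub_const (c := d.z) h.loop.diff_z hz
  refine ⟨h1.hasDerivWithinAt_zero (by norm_num) ht,
    (h1.hasDerivWithinAt (by norm_num : 1 < 2) ht).congr_deriv ?_,
    h.loop.diff_ψ.hasDerivWithinAt_zero (by norm_num) ht,
    (h.loop.diff_ψ.hasDerivWithinAt (by norm_num : 1 < 2) ht).congr_deriv (h.loop.eq_ψ t ht),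
    h.loop.diff_φ.hasDerivWithinAt_zero (by norm_num) ht,
    h.loop.diff_θ.hasDerivWithinAt_zero (by norm_num) ht, hφ, hθ⟩
  rw [h2 2 (by simp) t ht, h.loop.eq_z t ht, thrustInput]
  have : 1 / (cos (q.θ t) * cos (q.φ t)) * ubar g K r d q t * cos (q.θ t) * cos (q.φ t)
      = ubar g K r d q t := by
    field_simp
  rw [this, ubar, accZ]
  ring

theorem thrust_tilt_apply (u : ℝ) (q : Trajectory) (t : ℝ) :
    (u • (R2 (q.ψ t) * S)) *ᵥ tilt q t =
      ![u * (cos (q.ψ t) * tan (q.θ t) + sin (q.ψ t) * (tan (q.φ t) / cos (q.θ t))),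
        u * (sin (q.ψ t) * tan (q.θ t) - cos (q.ψ t) * (tan (q.φ t) / cos (q.θ t)))] := by
  ext i
  fin_cases i <;> simp [R2, S, tilt, Matrix.mulVec, dotProduct, Fin.sum_univ_two] <;> ring

theorem hasVecDeriv_accXY (hr : r.Admissible g) (ht : 0 ≤ t) (h : RegularAt K r d q t) :
    HasVecDeriv (accXY g K r d q) (jerkXY g K r d q t) (Ici 0) t := by
  refine (hasVecDeriv_thrust (g := g) h hr.smooth_z.1 ht).sub fun i => ?_
  fin_cases i
  · exact hr.smooth_x.1.hasDerivWithinAt (by norm_num : 2 < 4) ht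
  · exact hr.smooth_y.1.hasDerivWithinAt (by norm_num : 2 < 4) ht

theorem hasVecDeriv_jerkXY (hr : r.Admissible g) (ht : 0 ≤ t) (h : RegularAt K r d q t)
    {a : Fin 2 → ℝ} (ha : HasVecDeriv (rates q) a (Ici 0) t) :
    HasVecDeriv (jerkXY g K r d q)
      (Xi2 g K r d q t + (ubar g K r d q t • (R2 (q.ψ t) * S * Mt q t)) *ᵥ a
        - ![der 4 r.x t, der 4 r.y t]) (Ici 0) t := by
  refine (hasVecDeriv_jerk (g := g) h hr.smooth_z.1 ht ha).sub fun i => ?_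
  fin_cases i
  · exact hr.smooth_x.1.hasDerivWithinAt (by norm_num : 3 < 4) ht
  · exact hr.smooth_y.1.hasDerivWithinAt (by norm_num : 3 < 4) ht

/-- The torque law is inserted for the angular accelerations: the decoupling matrix cancels its
inverse, and `Xi2` and the fourth reference derivatives cancel too. -/
theorem Tracks.hasVecDeriv_jerkXY (hK : K.Admissible) (h : Tracks g K r d q) (ht : 0 ≤ t)
    (hq : Upright q t) :
    HasVecDeriv (jerkXY g K r d q) (linearInput g K r d q t) (Ici 0) t := by
  have hreg := h.regularAt ht hq
  have ha : HasVecDeriv (rates q) (rollPitchInput g K r d q t) (Ici 0) t := by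
    intro i
    fin_cases i
    · exact (h.loop.diff_φ.hasDerivWithinAt (by norm_num : 1 < 2) ht).congr_deriv
        (h.loop.eq_φ t ht)
    · exact (h.loop.diff_θ.hasDerivWithinAt (by norm_num : 1 < 2) ht).congr_deriv
        (h.loop.eq_θ t ht)
  refine (Quadrotor.hasVecDeriv_jerkXY (g := g) h.ref ht hreg ha).congr_deriv ?_
  have := (thrust_mulVec_eq_iff (a := q.ψ t) hreg.cosφ hreg.cosθ
    (ubar_pos hK h.bound ht).ne' (rollPitchInput g K r d q t) _).2 rfl
  rw [Mt, this]
  abel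

theorem Tracks.hasDerivWithinAt_errorChain_x (hK : K.Admissible) (h : Tracks g K r d q)
    (ht : 0 ≤ t) (hq : Upright q t) {k : ℕ} (hk : k < 4) :
    HasDerivWithinAt (errorChain g K r d q (errX r d q) 0 k)
      (errorChain g K r d q (errX r d q) 0 (k + 1) t) (Ici 0) t := by
  have hreg := h.regularAt ht hq
  have hφ := hreg.cosφ
  have hθ := hreg.cosθ
  obtain ⟨h1, h2⟩ := timesDiff_sub_sub_const (c := d.x) h.loop.diff_x
    (h.ref.smooth_x.1.mono (by norm_num : 2 ≤ 4))
  interval_cases k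
  · exact h1.hasDerivWithinAt_zero (by norm_num) ht
  · refine (h1.hasDerivWithinAt (by norm_num : 1 < 2) ht).congr_deriv ?_
    rw [h2 2 (by simp) t ht, h.loop.eq_x t ht, thrustInput]
    simp only [errorChain, accXY, thrust_tilt_apply]
    simp only [tan_eq_sin_div_cos, Pi.sub_apply, cons_val_zero]
    field_simp
  · exact hasVecDeriv_accXY h.ref ht hreg 0
  · exact h.hasVecDeriv_jerkXY hK ht hq 0

theorem Tracks.hasDerivWithinAt_errorChain_y (hK : K.Admissible) (h : Tracks g K r d q)
    (ht : 0 ≤ t) (hq : Upright q t) {k : ℕ} (hk : k < 4) :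
    HasDerivWithinAt (errorChain g K r d q (errY r d q) 1 k)
      (errorChain g K r d q (errY r d q) 1 (k + 1) t) (Ici 0) t := by
  have hreg := h.regularAt ht hq
  have hφ := hreg.cosφ
  have hθ := hreg.cosθ
  obtain ⟨h1, h2⟩ := timesDiff_sub_sub_const (c := d.y) h.loop.diff_y
    (h.ref.smooth_y.1.mono (by norm_num : 2 ≤ 4))
  interval_cases k
  · exact h1.hasDerivWithinAt_zero (by norm_num) ht
  · refine (h1.hasDerivWithinAt (by norm_num : 1 < 2) ht).congr_deriv ?_
    rw [h2 2 (by simp) t ht, h.loop.eq_y t ht, thrustInput]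
    simp only [errorChain, accXY, thrust_tilt_apply]
    simp only [tan_eq_sin_div_cos, Pi.sub_apply, cons_val_one]
    simp
    field_simp
  · exact hasVecDeriv_accXY h.ref ht hreg 1
  · exact h.hasVecDeriv_jerkXY hK ht hq 1

/-! ### No singularity is met -/

/-- The matrix taking `(w₀, w₁)` to `(a, b) / u` is an orthogonal reflection, hence its own inverse.
-/
theorem abs_tilt_le {u ψ a b w₀ w₁ : ℝ} (hu : 0 < u) (ha : a = u * (cos ψ * w₀ + sin ψ * w₁))
    (hb : b = u * (sin ψ * w₀ - cos ψ * w₁)) :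
    |w₀| ≤ (|a| + |b|) / u ∧ |w₁| ≤ (|a| + |b|) / u := by
  have h0 : w₀ * u = cos ψ * a + sin ψ * b := by
    rw [ha, hb]
    linear_combination (-(w₀ * u)) * sin_sq_add_cos_sq ψ
  have h1 : w₁ * u = sin ψ * a - cos ψ * b := by
    rw [ha, hb]
    linear_combination (-(w₁ * u)) * sin_sq_add_cos_sq ψ
  have hbound : ∀ x y : ℝ, |x| ≤ 1 → |y| ≤ 1 → |x * a| + |y * b| ≤ |a| + |b| := by
    intro x y hx hy
    rw [abs_mul, abs_mul]
    exact add_le_add (mul_le_of_le_one_left (abs_nonneg _) hx)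
      (mul_le_of_le_one_left (abs_nonneg _) hy)
  have hc := abs_cos_le_one ψ
  have hs := abs_sin_le_one ψ
  have habs : ∀ w : ℝ, |w| * u = |w * u| := fun w => by rw [abs_mul, abs_of_pos hu]
  constructor <;> rw [le_div_iff₀ hu, habs]
  · rw [h0]
    exact (abs_add_le _ _).trans (hbound _ _ hc hs)
  · rw [h1]
    exact (abs_sub _ _).trans (hbound _ _ hs hc)

theorem abs_le_arctan_of_abs_tan_le {x L : ℝ} (hx : x ∈ Ioo (-(π / 2)) (π / 2))
    (h : |tan x| ≤ L) : |x| ≤ arctan L := by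
  rw [abs_le] at h ⊢
  have := arctan_tan hx.1 hx.2
  exact ⟨by rw [← arctan_neg, ← this]; exact arctan_mono h.1,
    by rw [← this]; exact arctan_mono h.2⟩

/-- The bound on the tangent confines the angle to the closed interval `[-arctan L, arctan L]`, a
condition that survives the limit `t → T` and still lies inside `(-π/2, π/2)`. -/
theorem mem_Ioo_of_abs_tan_le {f : ℝ → ℝ} {T L : ℝ} (hT : 0 < T)
    (hf : ContinuousOn f (Ici 0)) (hIoo : ∀ t ∈ Ico 0 T, f t ∈ Ioo (-(π / 2)) (π / 2))
    (hL : ∀ t ∈ Ico 0 T, |tan (f t)| ≤ L) : f T ∈ Ioo (-(π / 2)) (π / 2) := by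
  have h1 : MapsTo f (Ico 0 T) (Icc (-arctan L) (arctan L)) := fun t ht =>
    abs_le.1 (abs_le_arctan_of_abs_tan_le (hIoo t ht) (hL t ht))
  have h2 := h1.closure_of_continuousOn (hf.mono (by
    rw [closure_Ico hT.ne]
    exact Icc_subset_Ici_self))
  rw [closure_Ico hT.ne, isClosed_Icc.closure_eq] at h2
  obtain ⟨h3, h4⟩ := h2 (right_mem_Icc.2 hT.le)
  have := arctan_lt_pi_div_two L
  exact ⟨by linarith, by linarith⟩

theorem TimesDiff.continuousOn {n k : ℕ} {f : ℝ → ℝ} (hf : TimesDiff n f) (hk : k < n) :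
    ContinuousOn (der k f) (Ici 0) := (hf k hk).continuousOn

/-- Up to time `T` the error equations hold, so the horizontal accelerations are bounded. Dividing
by a thrust bounded away from zero bounds both tangents. -/
theorem Tracks.upright_of_forall_lt (hK : K.Admissible) (h : Tracks g K r d q) {T : ℝ}
    (hT : 0 < T) (hq : ∀ t ∈ Ico 0 T, Upright q t) : Upright q T := by
  obtain ⟨Cx, hCx, cx, hcx, Hx⟩ := hK.hurwitz_x.exists_exponential_bound
  obtain ⟨Cy, hCy, cy, hcy, Hy⟩ := hK.hurwitz_y.exists_exponential_bound
  have hx := fun t ht => Hx T (errorChain g K r d q (errX r d q) 0)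
    (fun k hk t ht => h.hasDerivWithinAt_errorChain_x hK ht.1 (hq t ht) hk)
    (fun t _ => rfl) 2 (by norm_num) t ht
  have hy := fun t ht => Hy T (errorChain g K r d q (errY r d q) 1)
    (fun k hk t ht => h.hasDerivWithinAt_errorChain_y hK ht.1 (hq t ht) hk)
    (fun t _ => rfl) 2 (by norm_num) t ht
  simp only [errorChain] at hx hy
  obtain ⟨Bx, hBx⟩ := h.ref.smooth_x.2
  obtain ⟨By, hBy⟩ := h.ref.smooth_y.2
  -- The gain condition is strict at each time but has no uniform margin on `[0, ∞)`; on `[0, T]`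
  -- continuity of the reference acceleration supplies one.
  obtain ⟨m, hm, hmle⟩ := (isCompact_Icc (a := 0) (b := T)).exists_forall_le' (a := 0)
    (f := fun t => g - |der 2 r.z t| - K.k1z - K.k3z)
    (((continuousOn_const.sub ((h.ref.smooth_z.1.continuousOn (by norm_num : 2 < 4)).mono
      Icc_subset_Ici_self).abs).sub continuousOn_const).sub continuousOn_const)
    (fun t ht => by linarith [h.bound t ht.1])
  have hexp : ∀ {C c S₀ t : ℝ}, 0 < C → 0 < c → 0 ≤ S₀ → 0 ≤ t →
      C * exp (-c * t) * S₀ ≤ C * S₀ := by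
    intro C c S₀ t hC hc hS ht
    have : exp (-c * t) ≤ 1 := exp_le_one_iff.2 (by nlinarith)
    calc C * exp (-c * t) * S₀ ≤ C * 1 * S₀ := by gcongr
      _ = C * S₀ := by ring
  obtain ⟨Ax, hAx⟩ : ∃ A, ∀ t ∈ Ico 0 T, |accXY g K r d q t 0| ≤ A :=
    ⟨_, fun t ht => (hx t ht).trans
      (hexp hCx hcx (Finset.sum_nonneg fun _ _ => abs_nonneg _) ht.1)⟩
  obtain ⟨Ay, hAy⟩ : ∃ A, ∀ t ∈ Ico 0 T, |accXY g K r d q t 1| ≤ A :=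
    ⟨_, fun t ht => (hy t ht).trans
      (hexp hCy hcy (Finset.sum_nonneg fun _ _ => abs_nonneg _) ht.1)⟩
  set L := ((Ax + Bx) + (Ay + By)) / m with hL
  have key : ∀ t ∈ Ico 0 T, |tan (q.θ t)| ≤ L ∧ |tan (q.φ t)| ≤ L := by
    intro t ht
    have hu := ubar_pos (d := d) (q := q) hK h.bound ht.1
    have hmu : m ≤ ubar g K r d q t :=
      (hmle t (Ico_subset_Icc_self ht)).trans (le_ubar hK)
    have e0 : accXY g K r d q t 0 + der 2 r.x t = ubar g K r d q t *
        (cos (q.ψ t) * tan (q.θ t) + sin (q.ψ t) * (tan (q.φ t) / cos (q.θ t))) := by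
      simp only [accXY, thrust_tilt_apply]
      simp
    have e1 : accXY g K r d q t 1 + der 2 r.y t = ubar g K r d q t *
        (sin (q.ψ t) * tan (q.θ t) - cos (q.ψ t) * (tan (q.φ t) / cos (q.θ t))) := by
      simp only [accXY, thrust_tilt_apply]
      simp
    obtain ⟨h0, h1⟩ := abs_tilt_le hu e0 e1
    have hab : |accXY g K r d q t 0 + der 2 r.x t| + |accXY g K r d q t 1 + der 2 r.y t|
        ≤ (Ax + Bx) + (Ay + By) :=
      add_le_add
        ((abs_add_le _ _).trans (add_le_add (hAx t ht) (hBx 2 (by simp) t ht.1)))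
        ((abs_add_le _ _).trans (add_le_add (hAy t ht) (hBy 2 (by simp) t ht.1)))
    have hdiv : (|accXY g K r d q t 0 + der 2 r.x t| + |accXY g K r d q t 1 + der 2 r.y t|) /
        ubar g K r d q t ≤ L := by
      rw [hL]
      gcongr
      exact le_trans (by positivity) hab
    have hc : 0 < cos (q.θ t) := cos_pos_of_mem_Ioo (hq t ht).2
    refine ⟨h0.trans hdiv, le_trans ?_ (h1.trans hdiv)⟩
    -- As `0 < cos θ ≤ 1`, a bound on `tan φ / cos θ` also bounds `tan φ`.
    rw [abs_div, abs_of_pos hc]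
    exact le_div_self (abs_nonneg _) hc (cos_le_one _)
  have cφ : ContinuousOn q.φ (Ici 0) := by
    simpa [der_zero] using h.loop.diff_φ.continuousOn (by norm_num : 0 < 2)
  have cθ : ContinuousOn q.θ (Ici 0) := by
    simpa [der_zero] using h.loop.diff_θ.continuousOn (by norm_num : 0 < 2)
  exact ⟨mem_Ioo_of_abs_tan_le hT cφ (fun t ht => (hq t ht).1) fun t ht => (key t ht).2,
    mem_Ioo_of_abs_tan_le hT cθ (fun t ht => (hq t ht).2) fun t ht => (key t ht).1⟩

/-- Continuation argument: at the infimum `T` of the bad times the attitude is still regular, by the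
initial condition or the preceding lemma; regularity is an open condition, so no bad times
accumulate at `T`. -/
theorem Tracks.upright (hK : K.Admissible) (h : Tracks g K r d q) (ht : 0 ≤ t) :
    Upright q t := by
  by_contra hbad
  set B := {t | 0 ≤ t ∧ ¬ Upright q t} with hB
  have hne : B.Nonempty := ⟨t, ht, hbad⟩
  have hbdd : BddBelow B := ⟨0, fun s hs => hs.1⟩
  set T := sInf B
  have hT0 : 0 ≤ T := le_csInf hne fun s hs => hs.1
  have hlt : ∀ s ∈ Ico 0 T, Upright q s := fun s hs => by
    by_contra hs'
    exact absurd (csInf_le hbdd (show s ∈ B from ⟨hs.1, hs'⟩)) (not_le.2 hs.2)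
  have hT : Upright q T := by
    rcases hT0.eq_or_lt with h0 | h0
    · rw [← h0]
      exact ⟨h.roll, h.pitch⟩
    · exact h.upright_of_forall_lt hK h0 hlt
  have cφ : ContinuousOn q.φ (Ici 0) := by
    simpa [der_zero] using h.loop.diff_φ.continuousOn (by norm_num : 0 < 2)
  have cθ : ContinuousOn q.θ (Ici 0) := by
    simpa [der_zero] using h.loop.diff_θ.continuousOn (by norm_num : 0 < 2)
  have hev : ∀ᶠ s in 𝓝[Ici 0] T, Upright q s :=
    ((cφ T hT0).eventually (isOpen_Ioo.mem_nhds hT.1)).and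
      ((cθ T hT0).eventually (isOpen_Ioo.mem_nhds hT.2))
  obtain ⟨ε, hε, hball⟩ := Metric.mem_nhdsWithin_iff.1 hev
  obtain ⟨b, hb, hbT⟩ := exists_lt_of_csInf_lt hne (show sInf B < T + ε by linarith)
  refine hb.2 (hball ⟨?_, hb.1⟩)
  have : T ≤ b := csInf_le hbdd hb
  rw [Metric.mem_ball, dist_eq, abs_of_nonneg (by linarith)]
  linarith

/-! ### Tracking -/

theorem Tracks.isAltitudeError (hK : K.Admissible) (h : Tracks g K r d q) :
    IsAltitudeError K.k1z K.k2z K.k3z (errZ r d q) (der 1 (errZ r d q)) :=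
  ⟨fun _ ht => (h.regularAt ht (h.upright hK ht)).z0,
    fun _ ht => (h.regularAt ht (h.upright hK ht)).z1⟩

theorem Tracks.der_two_errZ (hK : K.Admissible) (h : Tracks g K r d q) (ht : 0 ≤ t) :
    der 2 (errZ r d q) t =
      altitudeAcc K.k1z K.k2z K.k3z (errZ r d q t, der 1 (errZ r d q) t) := by
  have h1 := (timesDiff_sub_sub_const (c := d.z) h.loop.diff_z
    (h.ref.smooth_z.1.mono (by norm_num : 2 ≤ 4))).1
  exact (uniqueDiffOn_Ici 0 t ht).eq_deriv _
    (h1.hasDerivWithinAt (by norm_num : 1 < 2) ht) ((h.isAltitudeError hK).snd t ht)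

theorem Tracks.errX_spec (hK : K.Admissible) (h : Tracks g K r d q) :
    TimesDiff 4 (errX r d q) ∧ ∀ k ≤ 4, EqOn (der k (errX r d q))
      (errorChain g K r d q (errX r d q) 0 k) (Ici 0) := by
  have hF : ∀ k < 4, ∀ t ≥ 0, HasDerivWithinAt (errorChain g K r d q (errX r d q) 0 k)
      (errorChain g K r d q (errX r d q) 0 (k + 1) t) (Ici 0) t := fun k hk t ht =>
    h.hasDerivWithinAt_errorChain_x hK ht (h.upright hK ht) hk
  exact ⟨timesDiff_of_chain hF, eqOn_der_of_chain hF⟩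

theorem Tracks.errY_spec (hK : K.Admissible) (h : Tracks g K r d q) :
    TimesDiff 4 (errY r d q) ∧ ∀ k ≤ 4, EqOn (der k (errY r d q))
      (errorChain g K r d q (errY r d q) 1 k) (Ici 0) := by
  have hF : ∀ k < 4, ∀ t ≥ 0, HasDerivWithinAt (errorChain g K r d q (errY r d q) 1 k)
      (errorChain g K r d q (errY r d q) 1 (k + 1) t) (Ici 0) t := fun k hk t ht =>
    h.hasDerivWithinAt_errorChain_y hK ht (h.upright hK ht) hk
  exact ⟨timesDiff_of_chain hF, eqOn_der_of_chain hF⟩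

end

theorem exists_horizontal_bound (g : ℝ) {K : Gains} (hK : K.Admissible) :
    ∃ C > 0, ∃ c > 0, ∀ (r : Reference) (d : Offset) (q : Trajectory), Tracks g K r d q →
      TimesDiff 4 (errX r d q) ∧ TimesDiff 4 (errY r d q) ∧
      ∀ k < 4, ∀ t ≥ 0,
        |der k (errX r d q) t| ≤ C * exp (-c * t) *
          ∑ j ∈ Finset.range 4, |der j (errX r d q) 0| ∧
        |der k (errY r d q) t| ≤ C * exp (-c * t) *
          ∑ j ∈ Finset.range 4, |der j (errY r d q) 0| := by
  obtain ⟨Cx, hCx, cx, hcx, Hx⟩ := hK.hurwitz_x.exists_exponential_bound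
  obtain ⟨Cy, hCy, cy, hcy, Hy⟩ := hK.hurwitz_y.exists_exponential_bound
  refine ⟨max Cx Cy, by positivity, min cx cy, by positivity, fun r d q h => ?_⟩
  obtain ⟨hx4, hx⟩ := h.errX_spec hK
  obtain ⟨hy4, hy⟩ := h.errY_spec hK
  refine ⟨hx4, hy4, fun k hk t ht => ⟨?_, ?_⟩⟩
  -- The bound holds on the half-open interval `[0, T)`, so any `T > t` serves.
  · have := Hx (t + 1) (fun k => der k (errX r d q))
      (fun k hk t ht => hx4.hasDerivWithinAt hk ht.1)
      (fun s hs => by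
        rw [hx 4 le_rfl hs.1, hx 0 (by norm_num) hs.1, hx 1 (by norm_num) hs.1,
          hx 2 (by norm_num) hs.1, hx 3 (by norm_num) hs.1]
        rfl) k hk t ⟨ht, by linarith⟩
    refine this.trans ?_
    gcongr
    · exact le_max_left _ _
    · exact min_le_left _ _
  · have := Hy (t + 1) (fun k => der k (errY r d q))
      (fun k hk t ht => hy4.hasDerivWithinAt hk ht.1)
      (fun s hs => by
        rw [hy 4 le_rfl hs.1, hy 0 (by norm_num) hs.1, hy 1 (by norm_num) hs.1,
          hy 2 (by norm_num) hs.1, hy 3 (by norm_num) hs.1]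
        rfl) k hk t ⟨ht, by linarith⟩
    refine this.trans ?_
    gcongr
    · exact le_max_right _ _
    · exact min_le_right _ _

theorem tendsto_zero_of_exponential_bound {f : ℝ → ℝ} {C c S₀ : ℝ} (hc : 0 < c)
    (hf : ∀ t ≥ 0, |f t| ≤ C * exp (-c * t) * S₀) : Tendsto f atTop (𝓝 0) := by
  have h1 : Tendsto (fun t : ℝ => exp (-c * t)) atTop (𝓝 0) :=
    tendsto_exp_atBot.comp (tendsto_id.const_mul_atTop_of_neg (neg_lt_zero.2 hc))
  have h2 : Tendsto (fun t : ℝ => C * exp (-c * t) * S₀) atTop (𝓝 0) := by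
    simpa using (h1.const_mul C).mul_const S₀
  exact squeeze_zero_norm' ((eventually_ge_atTop 0).mono hf) h2

section

variable {g : ℝ} {K : Gains} {r : Reference} {d : Offset} {q : Trajectory}

theorem Tracks.tendsto_yaw (hK : K.Admissible) (h : Tracks g K r d q) :
    Tendsto q.ψ atTop (𝓝 0) := by
  obtain ⟨C, hC, c, hc, H⟩ := exists_exponential_bound_quadratic hK.k1ψ_pos hK.k2ψ_pos
  refine tendsto_zero_of_exponential_bound (C := C)
    (S₀ := ∑ j ∈ Finset.range 2, |der j q.ψ 0|) hc fun t ht => ?_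
  have := H (t + 1) (fun k => der k q.ψ)
    (fun k hk t ht => h.loop.diff_ψ.hasDerivWithinAt hk ht.1)
    (fun s hs => by rw [h.loop.eq_ψ s hs.1, yawInput, der_zero]) 0 (by norm_num) t
    ⟨ht, by linarith⟩
  simpa only [der_zero] using this

theorem Tracks.tendsto_errors (hK : K.Admissible) (h : Tracks g K r d q) :
    Tendsto (errX r d q) atTop (𝓝 0) ∧ Tendsto (errY r d q) atTop (𝓝 0) ∧
      Tendsto (errZ r d q) atTop (𝓝 0) := by
  obtain ⟨C, hC, c, hc, H⟩ := exists_horizontal_bound g hK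
  obtain ⟨-, -, H⟩ := H r d q h
  refine ⟨tendsto_zero_of_exponential_bound (C := C)
      (S₀ := ∑ j ∈ Finset.range 4, |der j (errX r d q) 0|) hc fun t ht => ?_,
    tendsto_zero_of_exponential_bound (C := C)
      (S₀ := ∑ j ∈ Finset.range 4, |der j (errY r d q) 0|) hc fun t ht => ?_, ?_⟩
  · simpa only [der_zero] using (H 0 (by norm_num) t ht).1
  · simpa only [der_zero] using (H 0 (by norm_num) t ht).2
  · rw [Metric.tendsto_atTop]
    intro ε hε
    obtain ⟨T, -, HT⟩ := altitudeError_attractive hK.k1z_pos hK.k2z_pos hK.k3z_pos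
      (max |errZ r d q 0| |der 1 (errZ r d q) 0| + 1) hε
    refine ⟨T, fun t ht => ?_⟩
    rw [dist_zero_right]
    exact (HT _ _ (h.isAltitudeError hK) (lt_add_of_le_of_pos (le_max_left _ _) one_pos)
      (lt_add_of_le_of_pos (le_max_right _ _) one_pos) t ht).1

theorem Tracks.abs_der_errZ_lt (hK : K.Admissible) (h : Tracks g K r d q) {t ε : ℝ} (ht : 0 ≤ t)
    (hε : |errZ r d q t| < ε ∧ |der 1 (errZ r d q) t| < ε ∧
      |altitudeAcc K.k1z K.k2z K.k3z (errZ r d q t, der 1 (errZ r d q) t)| < ε) :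
    ∀ k < 3, |der k (errZ r d q) t| < ε := by
  intro k hk
  interval_cases k
  · rw [der_zero]
    exact hε.1
  · exact hε.2.1
  · rw [h.der_two_errZ hK ht]
    exact hε.2.2

end

/-! ### Twice differentiable signals -/

section

variable {f h f₁ f₂ : ℝ → ℝ}

theorem timesDiff_two_of_hasDerivWithinAt
    (h₁ : ∀ t ≥ 0, HasDerivWithinAt f (f₁ t) (Ici 0) t)
    (h₂ : ∀ t ≥ 0, HasDerivWithinAt f₁ (f₂ t) (Ici 0) t) : TimesDiff 2 f := by
  let F : ℕ → ℝ → ℝ := fun k => match k with | 0 => f | 1 => f₁ | _ => f₂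
  refine timesDiff_of_chain (F := F) fun k hk t ht => ?_
  interval_cases k
  · exact h₁ t ht
  · exact h₂ t ht

theorem TimesDiff.zero_one (hf : TimesDiff 2 f) {t : ℝ} (ht : 0 ≤ t) :
    HasDerivWithinAt f (der 1 f t) (Ici 0) t ∧
      HasDerivWithinAt (der 1 f) (der 2 f t) (Ici 0) t :=
  ⟨hf.hasDerivWithinAt_zero two_pos ht, hf.hasDerivWithinAt one_lt_two ht⟩

theorem TimesDiff.add_two (hf : TimesDiff 2 f) (hh : TimesDiff 2 h) :
    TimesDiff 2 (fun t => f t + h t) :=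
  timesDiff_two_of_hasDerivWithinAt
    (fun _ ht => (hf.zero_one ht).1.add (hh.zero_one ht).1)
    (fun _ ht => (hf.zero_one ht).2.add (hh.zero_one ht).2)

theorem TimesDiff.mul_two (hf : TimesDiff 2 f) (hh : TimesDiff 2 h) :
    TimesDiff 2 (fun t => f t * h t) :=
  timesDiff_two_of_hasDerivWithinAt
    (fun _ ht => (hf.zero_one ht).1.mul (hh.zero_one ht).1)
    (fun _ ht => ((hf.zero_one ht).2.mul (hh.zero_one ht).1).add
      ((hf.zero_one ht).1.mul (hh.zero_one ht).2))

theorem timesDiff_two_const (c : ℝ) : TimesDiff 2 (fun _ => c) :=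
  timesDiff_two_of_hasDerivWithinAt (fun _ _ => hasDerivWithinAt_const _ _ _)
    (fun _ _ => hasDerivWithinAt_const _ _ (0 : ℝ))

/-- Differentiability of the outer function is asked only at the values of `f`, so that inversion is
covered. -/
theorem TimesDiff.comp_two {F F₁ F₂ : ℝ → ℝ} (hf : TimesDiff 2 f)
    (h₁ : ∀ t ≥ 0, HasDerivAt F (F₁ (f t)) (f t))
    (h₂ : ∀ t ≥ 0, HasDerivAt F₁ (F₂ (f t)) (f t)) : TimesDiff 2 (fun t => F (f t)) :=
  timesDiff_two_of_hasDerivWithinAt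
    (fun t ht => (h₁ t ht).comp_hasDerivWithinAt t (hf.zero_one ht).1)
    (fun t ht => ((h₂ t ht).comp_hasDerivWithinAt t (hf.zero_one ht).1).mul (hf.zero_one ht).2)

theorem TimesDiff.comp_contDiff {F : ℝ → ℝ} (hf : TimesDiff 2 f) (hF : ContDiff ℝ 2 F) :
    TimesDiff 2 (fun t => F (f t)) := by
  have h1 : ContDiff ℝ 1 (deriv F) := hF.deriv'
  exact hf.comp_two
    (fun t _ => (hF.differentiable (by norm_num)).differentiableAt.hasDerivAt)
    (fun t _ => (h1.differentiable (by norm_num)).differentiableAt.hasDerivAt)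

theorem TimesDiff.inv_two (hf : TimesDiff 2 f) (h0 : ∀ t ≥ 0, f t ≠ 0) :
    TimesDiff 2 (fun t => (f t)⁻¹) :=
  hf.comp_two (F := fun x => x⁻¹) (F₁ := fun x => -(x ^ 2)⁻¹)
    (F₂ := fun x => -(-((2 : ℕ) * x ^ (2 - 1) * 1) / (x ^ 2) ^ 2))
    (fun t ht => hasDerivAt_inv (h0 t ht))
    (fun t ht => (((hasDerivAt_id' (f t)).fun_pow 2).fun_inv (pow_ne_zero 2 (h0 t ht))).fun_neg)

end

/-! ### Solutions of the error equations -/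

/-- The companion form turns the scalar equation into a first-order system with a linear, hence
Lipschitz, field. The entry `e n` is defined as the right-hand side. -/
theorem exists_linear_solution {n : ℕ} (c a : Fin n → ℝ) :
    ∃ e : ℕ → ℝ → ℝ, (∀ k : Fin n, e k 0 = a k) ∧
      (∀ k < n, ∀ t, HasDerivAt (e k) (e (k + 1) t) t) ∧
      ∀ t, e n t = ∑ j : Fin n, c j * e j t := by
  let A : (Fin n → ℝ) →ₗ[ℝ] (Fin n → ℝ) := LinearMap.pi fun i =>
    if h : (i : ℕ) + 1 < n then LinearMap.proj ⟨i + 1, h⟩ else ∑ j, c j • LinearMap.proj j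
  obtain ⟨γ, h0, h1⟩ := exists_forall_hasDerivAt_of_lipschitz
    (f := A.toContinuousLinearMap) (ContinuousLinearMap.contDiff _)
    (ContinuousLinearMap.lipschitz _) a
  let e : ℕ → ℝ → ℝ := fun k t => if h : k < n then γ t ⟨k, h⟩ else ∑ j, c j * γ t j
  have he : ∀ (k : Fin n) t, e k t = γ t k := fun k t => by simp [e]
  refine ⟨e, fun k => by rw [he, h0], fun k hk t => ?_, fun t => by simp [e]⟩
  have h2 := hasDerivAt_pi.1 (h1 t) ⟨k, hk⟩
  have h3 : e k = fun t => γ t ⟨k, hk⟩ := by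
    funext s
    exact he ⟨k, hk⟩ s
  rw [h3]
  refine h2.congr_deriv ?_
  by_cases h : k + 1 < n <;> simp [A, e, h]

/-- As `tanh` is 1-Lipschitz, the field is globally Lipschitz and its solutions exist for all times.
-/
theorem exists_altitude_solution (k₁ k₂ k₃ : ℝ) (a : ℝ × ℝ) :
    ∃ e p : ℝ → ℝ, e 0 = a.1 ∧ p 0 = a.2 ∧ (∀ t, HasDerivAt e (p t) t) ∧
      ∀ t, HasDerivAt p (altitudeAcc k₁ k₂ k₃ (e t, p t)) t := by
  have hsmooth : ContDiff ℝ 1 fun s : ℝ × ℝ => (s.2, altitudeAcc k₁ k₂ k₃ s) := by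
    have h : ContDiff ℝ 1 tanh := contDiff_tanh
    unfold altitudeAcc
    exact contDiff_snd.prodMk (((contDiff_const.mul (h.comp (by fun_prop))).sub
      (contDiff_const.mul (h.comp contDiff_snd))))
  have hlip : ∃ L, LipschitzWith L fun s : ℝ × ℝ => (s.2, altitudeAcc k₁ k₂ k₃ s) :=
    ⟨_, LipschitzWith.prod_snd.prodMk
      (((lipschitzWith_smul (-k₁)).comp (lipschitzWith_tanh.comp (LipschitzWith.prod_snd.add
        ((lipschitzWith_smul k₂).comp LipschitzWith.prod_fst)))).sub
      ((lipschitzWith_smul k₃).comp (lipschitzWith_tanh.comp LipschitzWith.prod_snd)))⟩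
  obtain ⟨L, hL⟩ := hlip
  obtain ⟨γ, h0, h1⟩ := exists_forall_hasDerivAt_of_lipschitz hsmooth hL a
  exact ⟨fun t => (γ t).1, fun t => (γ t).2, by simp [h0], by simp [h0],
    fun t => (hasFDerivAt_fst (p := γ t)).comp_hasDerivAt t (h1 t),
    fun t => (hasFDerivAt_snd (p := γ t)).comp_hasDerivAt t (h1 t)⟩

/-- Signals that obey the closed-loop error equations, with their derivatives. -/
structure ErrorSystem (K : Gains) (X Y Z Ψ : ℕ → ℝ → ℝ) : Prop where
  x : ∀ k < 4, ∀ t ≥ 0, HasDerivWithinAt (X k) (X (k + 1) t) (Ici 0) t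
  x4 : ∀ t, X 4 t = -K.k1x * X 0 t - K.k2x * X 1 t - K.k3x * X 2 t - K.k4x * X 3 t
  y : ∀ k < 4, ∀ t ≥ 0, HasDerivWithinAt (Y k) (Y (k + 1) t) (Ici 0) t
  y4 : ∀ t, Y 4 t = -K.k1y * Y 0 t - K.k2y * Y 1 t - K.k3y * Y 2 t - K.k4y * Y 3 t
  z : ∀ k < 2, ∀ t ≥ 0, HasDerivWithinAt (Z k) (Z (k + 1) t) (Ici 0) t
  z2 : ∀ t, Z 2 t = altitudeAcc K.k1z K.k2z K.k3z (Z 0 t, Z 1 t)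
  ψ : ∀ k < 2, ∀ t ≥ 0, HasDerivWithinAt (Ψ k) (Ψ (k + 1) t) (Ici 0) t
  ψ2 : ∀ t, Ψ 2 t = -K.k1ψ * Ψ 0 t - K.k2ψ * Ψ 1 t

theorem exists_errorSystem (K : Gains) (x₀ y₀ z₀ ψ₀ : ℕ → ℝ) :
    ∃ X Y Z Ψ : ℕ → ℝ → ℝ, ErrorSystem K X Y Z Ψ ∧ (∀ k < 4, X k 0 = x₀ k) ∧
      (∀ k < 4, Y k 0 = y₀ k) ∧ (∀ k < 2, Z k 0 = z₀ k) ∧ ∀ k < 2, Ψ k 0 = ψ₀ k := by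
  obtain ⟨X, hX0, hX, hX4⟩ := exists_linear_solution ![-K.k1x, -K.k2x, -K.k3x, -K.k4x]
    (fun k => x₀ k)
  obtain ⟨Y, hY0, hY, hY4⟩ := exists_linear_solution ![-K.k1y, -K.k2y, -K.k3y, -K.k4y]
    (fun k => y₀ k)
  obtain ⟨Ψ, hΨ0, hΨ, hΨ2⟩ := exists_linear_solution ![-K.k1ψ, -K.k2ψ] (fun k => ψ₀ k)
  obtain ⟨e, p, he0, hp0, he, hp⟩ := exists_altitude_solution K.k1z K.k2z K.k3z (z₀ 0, z₀ 1)
  refine ⟨X, Y, fun k => match k with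
      | 0 => e | 1 => p | _ => fun t => altitudeAcc K.k1z K.k2z K.k3z (e t, p t), Ψ,
    ⟨fun k hk t _ => (hX k hk t).hasDerivWithinAt, fun t => ?_,
      fun k hk t _ => (hY k hk t).hasDerivWithinAt, fun t => ?_, fun k hk t _ => ?_,
      fun _ => rfl, fun k hk t _ => (hΨ k hk t).hasDerivWithinAt, fun t => ?_⟩,
    fun k hk => hX0 ⟨k, hk⟩, fun k hk => hY0 ⟨k, hk⟩, fun k hk => ?_, fun k hk => hΨ0 ⟨k, hk⟩⟩
  · rw [hX4 t]
    simp [Fin.sum_univ_four]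
    ring
  · rw [hY4 t]
    simp [Fin.sum_univ_four]
    ring
  · interval_cases k
    · exact (he t).hasDerivWithinAt
    · exact (hp t).hasDerivWithinAt
  · rw [hΨ2 t]
    simp [Fin.sum_univ_two]
    ring
  · interval_cases k
    · exact he0
    · exact hp0

/-! ### The motion with prescribed errors -/

section

variable (g : ℝ) (K : Gains) (r : Reference) (d : Offset) (X Y Z Ψ : ℕ → ℝ → ℝ)

/-- The thrust variable `ū₁` that belongs to the altitude error `Z`. -/
noncomputable def plannedThrust (t : ℝ) : ℝ :=
  g + der 2 r.z t + altitudeAcc K.k1z K.k2z K.k3z (Z 0 t, Z 1 t)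

/-- `tan θ` along the motion with prescribed errors. -/
noncomputable def plannedTilt₀ (t : ℝ) : ℝ :=
  (cos (Ψ 0 t) * (X 2 t + der 2 r.x t) + sin (Ψ 0 t) * (Y 2 t + der 2 r.y t))
    * (plannedThrust g K r Z t)⁻¹

/-- `tan φ / cos θ` along the motion with prescribed errors. -/
noncomputable def plannedTilt₁ (t : ℝ) : ℝ :=
  (sin (Ψ 0 t) * (X 2 t + der 2 r.x t) + -1 * (cos (Ψ 0 t) * (Y 2 t + der 2 r.y t)))
    * (plannedThrust g K r Z t)⁻¹

/-- The motion with prescribed position errors and yaw. -/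
noncomputable def plannedTrajectory : Trajectory where
  x t := X 0 t + r.x t + d.x
  y t := Y 0 t + r.y t + d.y
  z t := Z 0 t + r.z t + d.z
  φ t := arctan (plannedTilt₁ g K r X Y Z Ψ t * cos (arctan (plannedTilt₀ g K r X Y Z Ψ t)))
  θ t := arctan (plannedTilt₀ g K r X Y Z Ψ t)
  ψ := Ψ 0

theorem errX_plannedTrajectory : errX r d (plannedTrajectory g K r d X Y Z Ψ) = X 0 := by
  funext t
  simp only [errX, plannedTrajectory]
  ring

theorem errY_plannedTrajectory : errY r d (plannedTrajectory g K r d X Y Z Ψ) = Y 0 := by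
  funext t
  simp only [errY, plannedTrajectory]
  ring

theorem errZ_plannedTrajectory : errZ r d (plannedTrajectory g K r d X Y Z Ψ) = Z 0 := by
  funext t
  simp only [errZ, plannedTrajectory]
  ring

theorem upright_plannedTrajectory (t : ℝ) : Upright (plannedTrajectory g K r d X Y Z Ψ) t :=
  ⟨arctan_mem_Ioo _, arctan_mem_Ioo _⟩

end

theorem timesDiff_chain_add_add_const {n : ℕ} {F : ℕ → ℝ → ℝ} {f : ℝ → ℝ} (c : ℝ)
    (hF : ∀ k < n, ∀ t ≥ 0, HasDerivWithinAt (F k) (F (k + 1) t) (Ici 0) t)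
    (hf : TimesDiff n f) :
    TimesDiff n (fun t => F 0 t + f t + c) ∧
      ∀ k ∈ Icc 1 n, ∀ t ≥ 0, der k (fun t => F 0 t + f t + c) t = F k t + der k f t := by
  let G : ℕ → ℝ → ℝ := fun k t => F k t + der k f t + if k = 0 then c else 0
  have hG : ∀ k < n, ∀ t ≥ 0, HasDerivWithinAt (G k) (G (k + 1) t) (Ici 0) t := by
    intro k hk t ht
    refine (((hF k hk t ht).add (hf.hasDerivWithinAt hk ht)).add_const _).congr_deriv ?_
    simp [G]
  have h0 : G 0 = fun t => F 0 t + f t + c := by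
    funext t
    simp [G, der_zero]
  rw [← h0]
  refine ⟨timesDiff_of_chain hG, fun k hk t ht => ?_⟩
  rw [eqOn_der_of_chain hG k hk.2 ht]
  have : k ≠ 0 := by have := hk.1; omega
  simp [G, this]

section

variable {g : ℝ} {K : Gains} {r : Reference} {d : Offset} {X Y Z Ψ : ℕ → ℝ → ℝ}

local notation "qₚ" => plannedTrajectory g K r d X Y Z Ψ

theorem ErrorSystem.der_errZ (h : ErrorSystem K X Y Z Ψ) {t : ℝ} (ht : 0 ≤ t) :
    der 1 (errZ r d qₚ) t = Z 1 t := by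
  rw [errZ_plannedTrajectory]
  exact eqOn_der_of_chain h.z 1 (by norm_num) ht

theorem ErrorSystem.ubar_eq (h : ErrorSystem K X Y Z Ψ) {t : ℝ} (ht : 0 ≤ t) :
    ubar g K r d qₚ t = plannedThrust g K r Z t := by
  rw [ubar, h.der_errZ ht, errZ_plannedTrajectory, plannedThrust, altitudeAcc]
  ring

theorem ErrorSystem.plannedThrust_pos (h : ErrorSystem K X Y Z Ψ) (hK : K.Admissible)
    (hr : ThrustBound g K r) {t : ℝ} (ht : 0 ≤ t) : 0 < plannedThrust g K r Z t := by
  -- The planned thrust does not depend on the offset, so any offset may be chosen here.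
  rw [← h.ubar_eq (d := ⟨0, 0, 0⟩) ht]
  exact ubar_pos hK hr ht

/-- The attitude is a smooth function of yaw, thrust and horizontal accelerations, the thrust being
nonzero. Each of these is twice differentiable: this is where all four derivatives of the reference
are used. -/
theorem ErrorSystem.timesDiff_attitude (h : ErrorSystem K X Y Z Ψ) (hK : K.Admissible)
    (hr : r.Admissible g) (hb : ThrustBound g K r) :
    TimesDiff 2 (qₚ).φ ∧ TimesDiff 2 (qₚ).θ := by
  have hder : ∀ {f}, TimesDiff 4 f → TimesDiff 2 (der 2 f) := fun hf =>
    timesDiff_two_of_hasDerivWithinAt (fun t ht => hf.hasDerivWithinAt (by norm_num : 2 < 4) ht)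
      (fun t ht => hf.hasDerivWithinAt (by norm_num : 3 < 4) ht)
  have hψ : TimesDiff 2 (Ψ 0) := timesDiff_of_chain h.ψ
  have hx : TimesDiff 2 (X 2) := timesDiff_two_of_hasDerivWithinAt
    (h.x 2 (by norm_num)) (h.x 3 (by norm_num))
  have hy : TimesDiff 2 (Y 2) := timesDiff_two_of_hasDerivWithinAt
    (h.y 2 (by norm_num)) (h.y 3 (by norm_num))
  have hz0 : TimesDiff 2 (Z 0) := timesDiff_of_chain h.z
  -- The altitude chain stops at `Z 2`; one more derivative comes from `Z 2` being a smooth function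
  -- of `Z 0` and `Z 1`.
  have hz1 : TimesDiff 2 (Z 1) := by
    refine timesDiff_two_of_hasDerivWithinAt (h.z 1 (by norm_num))
      (f₂ := fun t => -K.k1z * ((1 - tanh (Z 1 t + K.k2z * Z 0 t) ^ 2) *
        (Z 2 t + K.k2z * Z 1 t)) - K.k3z * ((1 - tanh (Z 1 t) ^ 2) * Z 2 t)) fun t ht => ?_
    have e : Z 2 = fun t => altitudeAcc K.k1z K.k2z K.k3z (Z 0 t, Z 1 t) := funext h.z2
    have d0 := h.z 0 (by norm_num) t ht
    have d1 := h.z 1 (by norm_num) t ht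
    have := ((hasDerivWithinAt_tanh_comp (d1.add (d0.const_mul K.k2z))).const_mul (-K.k1z)).sub
      ((hasDerivWithinAt_tanh_comp d1).const_mul K.k3z)
    refine (this.congr (fun s _ => ?_) ?_).congr_deriv rfl
    · exact h.z2 s
    · exact h.z2 t
  have hcos : ContDiff ℝ 2 cos := contDiff_cos
  have hsin : ContDiff ℝ 2 sin := contDiff_sin
  have hatan : ContDiff ℝ 2 arctan := contDiff_arctan
  have hU : TimesDiff 2 (plannedThrust g K r Z) := by
    have h1 := (hz1.add_two ((timesDiff_two_const K.k2z).mul_two hz0)).comp_contDiff contDiff_tanh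
    have h2 := hz1.comp_contDiff contDiff_tanh
    have h3 := ((timesDiff_two_const g).add_two (hder hr.smooth_z.1)).add_two
      (((timesDiff_two_const (-K.k1z)).mul_two h1).add_two
        ((timesDiff_two_const (-K.k3z)).mul_two h2))
    convert h3 using 2 with t
    rw [plannedThrust, altitudeAcc]
    ring
  have hUinv := hU.inv_two fun t ht => (h.plannedThrust_pos hK hb ht).ne'
  have ha := hx.add_two (hder hr.smooth_x.1)
  have hb' := hy.add_two (hder hr.smooth_y.1)
  have hc := hψ.comp_contDiff hcos
  have hs := hψ.comp_contDiff hsin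
  have h0 : TimesDiff 2 (plannedTilt₀ g K r X Y Z Ψ) :=
    ((hc.mul_two ha).add_two (hs.mul_two hb')).mul_two hUinv
  have h1 : TimesDiff 2 (plannedTilt₁ g K r X Y Z Ψ) :=
    ((hs.mul_two ha).add_two ((timesDiff_two_const (-1)).mul_two (hc.mul_two hb'))).mul_two hUinv
  have hθ := h0.comp_contDiff hatan
  exact ⟨(h1.mul_two (hθ.comp_contDiff hcos)).comp_contDiff hatan, hθ⟩

theorem ErrorSystem.regularAt (h : ErrorSystem K X Y Z Ψ) (hK : K.Admissible)
    (hr : r.Admissible g) (hb : ThrustBound g K r) {t : ℝ} (ht : 0 ≤ t) :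
    RegularAt K r d qₚ t := by
  obtain ⟨hφ, hθ⟩ := h.timesDiff_attitude (d := d) hK hr hb
  have hz : TimesDiff 2 (Z 0) := timesDiff_of_chain h.z
  have hψ : TimesDiff 2 (Ψ 0) := timesDiff_of_chain h.ψ
  have hup := upright_plannedTrajectory g K r d X Y Z Ψ t
  refine ⟨?_, ?_, hψ.hasDerivWithinAt_zero two_pos ht,
    (hψ.hasDerivWithinAt one_lt_two ht).congr_deriv ?_, hφ.hasDerivWithinAt_zero two_pos ht,
    hθ.hasDerivWithinAt_zero two_pos ht, (cos_pos_of_mem_Ioo hup.1).ne',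
    (cos_pos_of_mem_Ioo hup.2).ne'⟩
  · rw [errZ_plannedTrajectory]
    exact hz.hasDerivWithinAt_zero two_pos ht
  · rw [accZ, h.der_errZ ht, errZ_plannedTrajectory]
    refine (hz.hasDerivWithinAt one_lt_two ht).congr_deriv ?_
    rw [eqOn_der_of_chain h.z 2 le_rfl ht, h.z2, altitudeAcc]
  · rw [yawInput, eqOn_der_of_chain h.ψ 2 le_rfl ht, h.ψ2]
    simp only [plannedTrajectory]
    rw [eqOn_der_of_chain h.ψ 1 one_le_two ht]

theorem ErrorSystem.tilt_eq (t : ℝ) :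
    tan ((qₚ).θ t) = plannedTilt₀ g K r X Y Z Ψ t ∧
      tan ((qₚ).φ t) / cos ((qₚ).θ t) = plannedTilt₁ g K r X Y Z Ψ t := by
  have := (cos_pos_of_mem_Ioo (upright_plannedTrajectory g K r d X Y Z Ψ t).2).ne'
  simp only [plannedTrajectory] at this ⊢
  simp only [tan_arctan, true_and]
  field_simp

theorem ErrorSystem.thrust_tilt (h : ErrorSystem K X Y Z Ψ) (hK : K.Admissible)
    (hb : ThrustBound g K r) {t : ℝ} (ht : 0 ≤ t) :
    (ubar g K r d qₚ t • (R2 ((qₚ).ψ t) * S)) *ᵥ tilt qₚ t =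
      ![X 2 t + der 2 r.x t, Y 2 t + der 2 r.y t] := by
  have hU := (h.plannedThrust_pos hK hb ht).ne'
  obtain ⟨h0, h1⟩ := ErrorSystem.tilt_eq (g := g) (K := K) (r := r) (d := d) (X := X) (Y := Y)
    (Z := Z) (Ψ := Ψ) t
  rw [thrust_tilt_apply, h0, h1, h.ubar_eq ht]
  have hψ : (qₚ).ψ t = Ψ 0 t := rfl
  simp only [hψ, plannedTilt₀, plannedTilt₁]
  congr 1
  · field_simp
    linear_combination (X 2 t + der 2 r.x t) * sin_sq_add_cos_sq (Ψ 0 t)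
  · congr 1
    field_simp
    linear_combination (Y 2 t + der 2 r.y t) * sin_sq_add_cos_sq (Ψ 0 t)

theorem ErrorSystem.accXY_eq (h : ErrorSystem K X Y Z Ψ) (hK : K.Admissible)
    (hb : ThrustBound g K r) {t : ℝ} (ht : 0 ≤ t) :
    accXY g K r d qₚ t = ![X 2 t, Y 2 t] := by
  rw [accXY, h.thrust_tilt hK hb ht]
  simp

theorem ErrorSystem.hasVecDeriv (h : ErrorSystem K X Y Z Ψ) {k : ℕ} (hk : k < 4) {t : ℝ}
    (ht : 0 ≤ t) :
    HasVecDeriv (fun t => ![X k t, Y k t]) ![X (k + 1) t, Y (k + 1) t] (Ici 0) t := by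
  intro i
  fin_cases i
  · exact h.x k hk t ht
  · exact h.y k hk t ht

theorem HasVecDeriv.eq_of_eqOn {ι : Type*} {v w : ℝ → ι → ℝ} {v' w' : ι → ℝ} {t : ℝ} (ht : 0 ≤ t)
    (hv : HasVecDeriv v v' (Ici 0) t) (hw : HasVecDeriv w w' (Ici 0) t)
    (heq : ∀ s ≥ 0, v s = w s) : v' = w' := by
  funext i
  exact (uniqueDiffOn_Ici 0 t ht).eq_deriv _ (hv i)
    ((hw i).congr (fun s hs => by rw [heq s hs]) (by rw [heq t ht]))

/-- No computation is needed: `accXY` and `(X 2, Y 2)` agree on `[0, ∞)`, hence so do their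
derivatives. -/
theorem ErrorSystem.jerkXY_eq (h : ErrorSystem K X Y Z Ψ) (hK : K.Admissible)
    (hr : r.Admissible g) (hb : ThrustBound g K r) {t : ℝ} (ht : 0 ≤ t) :
    jerkXY g K r d qₚ t = ![X 3 t, Y 3 t] :=
  (hasVecDeriv_accXY hr ht (h.regularAt hK hr hb ht)).eq_of_eqOn ht
    (h.hasVecDeriv (by norm_num : 2 < 4) ht) fun _ hs => h.accXY_eq hK hb hs

theorem ErrorSystem.linearInput_eq (h : ErrorSystem K X Y Z Ψ) (hK : K.Admissible)
    (hr : r.Admissible g) (hb : ThrustBound g K r) {t : ℝ} (ht : 0 ≤ t) :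
    linearInput g K r d qₚ t = ![X 4 t, Y 4 t] := by
  rw [linearInput, h.accXY_eq hK hb ht, h.jerkXY_eq hK hr hb ht, errX_plannedTrajectory,
    errY_plannedTrajectory, h.x4, h.y4, eqOn_der_of_chain h.x 1 (by norm_num) ht,
    eqOn_der_of_chain h.y 1 (by norm_num) ht]
  simp

/-- Differentiating the identity for the third derivatives gives a linear equation for the still
unknown `(φ'', θ'')`; inverting the decoupling matrix turns it into the torque law. -/
theorem ErrorSystem.rollPitch_eq (h : ErrorSystem K X Y Z Ψ) (hK : K.Admissible)
    (hr : r.Admissible g) (hb : ThrustBound g K r) {t : ℝ} (ht : 0 ≤ t) :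
    ![der 2 (qₚ).φ t, der 2 (qₚ).θ t] = rollPitchInput g K r d qₚ t := by
  have hreg := h.regularAt (d := d) hK hr hb ht
  obtain ⟨hφ, hθ⟩ := h.timesDiff_attitude (d := d) hK hr hb
  have ha : HasVecDeriv (rates qₚ) ![der 2 (qₚ).φ t, der 2 (qₚ).θ t] (Ici 0) t := by
    intro i
    fin_cases i
    · exact hφ.hasDerivWithinAt one_lt_two ht
    · exact hθ.hasDerivWithinAt one_lt_two ht
  have key := (hasVecDeriv_jerkXY (g := g) hr ht hreg ha).eq_of_eqOn ht
    (h.hasVecDeriv (by norm_num : 3 < 4) ht) fun _ hs => h.jerkXY_eq hK hr hb hs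
  refine (thrust_mulVec_eq_iff (a := (qₚ).ψ t) hreg.cosφ hreg.cosθ (ubar_pos hK hb ht).ne' _ _).1 ?_
  rw [h.linearInput_eq hK hr hb ht, ← key, Mt]
  abel

theorem ErrorSystem.closedLoop (h : ErrorSystem K X Y Z Ψ) (hK : K.Admissible)
    (hr : r.Admissible g) (hb : ThrustBound g K r) : ClosedLoop g K r d qₚ := by
  obtain ⟨hφ, hθ⟩ := h.timesDiff_attitude (d := d) hK hr hb
  obtain ⟨hx2, hx⟩ := timesDiff_chain_add_add_const d.x (fun k (hk : k < 2) => h.x k (by omega))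
    (hr.smooth_x.1.mono (by norm_num : 2 ≤ 4))
  obtain ⟨hy2, hy⟩ := timesDiff_chain_add_add_const d.y (fun k (hk : k < 2) => h.y k (by omega))
    (hr.smooth_y.1.mono (by norm_num : 2 ≤ 4))
  obtain ⟨hz2, hz⟩ := timesDiff_chain_add_add_const d.z h.z (hr.smooth_z.1.mono (by norm_num : 2 ≤ 4))
  have hcos : ∀ t, cos ((qₚ).φ t) ≠ 0 ∧ cos ((qₚ).θ t) ≠ 0 := fun t =>
    ⟨(cos_pos_of_mem_Ioo (upright_plannedTrajectory g K r d X Y Z Ψ t).1).ne',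
      (cos_pos_of_mem_Ioo (upright_plannedTrajectory g K r d X Y Z Ψ t).2).ne'⟩
  refine ⟨hx2, hy2, hz2, hφ, hθ, timesDiff_of_chain h.ψ, fun t ht => ?_, fun t ht => ?_,
    fun t ht => ?_, fun t ht => congrFun (h.rollPitch_eq hK hr hb ht) 0,
    fun t ht => congrFun (h.rollPitch_eq hK hr hb ht) 1, fun t ht => ?_⟩
  · have e := congrFun (h.thrust_tilt (d := d) hK hb ht) 0
    rw [thrust_tilt_apply] at e
    refine (hx 2 (by simp) t ht).trans (e.symm.trans ?_)
    obtain ⟨h1, h2⟩ := hcos t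
    simp only [thrustInput, tan_eq_sin_div_cos, cons_val_zero]
    field_simp
  · have e := congrFun (h.thrust_tilt (d := d) hK hb ht) 1
    rw [thrust_tilt_apply] at e
    refine (hy 2 (by simp) t ht).trans (e.symm.trans ?_)
    obtain ⟨h1, h2⟩ := hcos t
    simp only [thrustInput, tan_eq_sin_div_cos, cons_val_one]
    simp
    field_simp
  · refine (hz 2 (by simp) t ht).trans ?_
    obtain ⟨h1, h2⟩ := hcos t
    have e : thrustInput g K r d qₚ t * cos ((qₚ).θ t) * cos ((qₚ).φ t) = ubar g K r d qₚ t := by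
      rw [thrustInput]
      field_simp
    rw [e, h.ubar_eq ht, plannedThrust, h.z2]
    ring
  · exact (uniqueDiffOn_Ici 0 t ht).eq_deriv _
      ((timesDiff_of_chain h.ψ : TimesDiff 2 (Ψ 0)).hasDerivWithinAt one_lt_two ht)
      (h.regularAt (d := d) hK hr hb ht).ψ1

end

/-! ### Prescribing the initial state -/

/-- A trajectory with initial state `(p, v)`, moving uniformly. -/
noncomputable def uniformTrajectory (p v : Config) : Trajectory where
  x t := p.x + v.x * t
  y t := p.y + v.y * t
  z t := p.z + v.z * t
  φ t := p.φ + v.φ * t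
  θ t := p.θ + v.θ * t
  ψ t := p.ψ + v.ψ * t

theorem der_uniform (a b : ℝ) : TimesDiff 2 (fun t => a + b * t) ∧
    der 1 (fun t => a + b * t) 0 = b := by
  have h1 : ∀ t ≥ (0 : ℝ), HasDerivWithinAt (fun t => a + b * t) b (Ici 0) t := fun t _ => by
    simpa using (((hasDerivAt_id t).const_mul b).const_add a).hasDerivWithinAt
  have h2 := timesDiff_two_of_hasDerivWithinAt h1 (fun _ _ => hasDerivWithinAt_const _ _ b)
  exact ⟨h2, (uniqueDiffOn_Ici 0 0 self_mem_Ici).eq_deriv _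
    (h2.hasDerivWithinAt_zero two_pos le_rfl) (h1 0 le_rfl)⟩

theorem uniformTrajectory_hasInitialState (p v : Config) :
    (uniformTrajectory p v).HasInitialState p v := by
  constructor <;> first
    | exact (der_uniform _ _).2
    | simp [uniformTrajectory]

section

variable {g : ℝ} {K : Gains} {r : Reference} {d : Offset} {q q' : Trajectory}

theorem Xi1_congr {t : ℝ} (hz : errZ r d q t = errZ r d q' t)
    (hz' : der 1 (errZ r d q) t = der 1 (errZ r d q') t) (hψ : q.ψ t = q'.ψ t)
    (hψ' : der 1 q.ψ t = der 1 q'.ψ t) (hφ : q.φ t = q'.φ t) (hθ : q.θ t = q'.θ t) :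
    Xi1 g K r d q t = Xi1 g K r d q' t := by
  simp only [Xi1, ubarD, ubar, accZ, R2D, tilt, hz, hz', hψ, hψ', hφ, hθ]

theorem ubar_congr {t : ℝ} (hz : errZ r d q t = errZ r d q' t)
    (hz' : der 1 (errZ r d q) t = der 1 (errZ r d q') t) :
    ubar g K r d q t = ubar g K r d q' t := by
  simp only [ubar, hz, hz']

end

/-- The feedback quantities take a trajectory, but at time `0` they see only its state. The uniform
motion, not itself a solution, carries the prescribed state and supplies the initial errors with
their derivatives. The planned motion with these errors then starts in that state, since
accelerations determine the angles and third derivatives the angular rates. -/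
theorem exists_closedLoop {g : ℝ} {K : Gains} (hK : K.Admissible) {r : Reference} (d : Offset)
    {p v : Config} (hr : r.Admissible g) (hb : ThrustBound g K r)
    (hφ : p.φ ∈ Ioo (-(π / 2)) (π / 2)) (hθ : p.θ ∈ Ioo (-(π / 2)) (π / 2)) :
    ∃ q : Trajectory, ClosedLoop g K r d q ∧ q.HasInitialState p v ∧ ∀ t, Upright q t := by
  set q₀ := uniformTrajectory p v with hq₀
  have hi := uniformTrajectory_hasInitialState p v
  rw [← hq₀] at hi
  obtain ⟨X, Y, Z, Ψ, h, hX, hY, hZ, hΨ⟩ := exists_errorSystem K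
    (fun k => errorChain g K r d q₀ (errX r d q₀) 0 k 0)
    (fun k => errorChain g K r d q₀ (errY r d q₀) 1 k 0)
    (fun k => der k (errZ r d q₀) 0) (fun k => der k q₀.ψ 0)
  set q := plannedTrajectory g K r d X Y Z Ψ with hq
  have hcosφ := (cos_pos_of_mem_Ioo hφ).ne'
  have hcosθ := (cos_pos_of_mem_Ioo hθ).ne'
  have ez : errZ r d q 0 = errZ r d q₀ 0 := by
    rw [hq, errZ_plannedTrajectory, hZ 0 two_pos, der_zero]
  have ez' : der 1 (errZ r d q) 0 = der 1 (errZ r d q₀) 0 := by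
    rw [hq, h.der_errZ le_rfl, hZ 1 one_lt_two]
  have eψ : q.ψ 0 = q₀.ψ 0 := by
    change Ψ 0 0 = _
    rw [hΨ 0 two_pos, der_zero]
  have eψ' : der 1 q.ψ 0 = der 1 q₀.ψ 0 := by
    change der 1 (Ψ 0) 0 = _
    rw [eqOn_der_of_chain h.ψ 1 one_le_two self_mem_Ici, hΨ 1 one_lt_two]
  have eU : ubar g K r d q 0 = ubar g K r d q₀ 0 := ubar_congr ez ez'
  have hU : ubar g K r d q₀ 0 ≠ 0 := (ubar_pos hK hb le_rfl).ne'
  have hthrust := h.thrust_tilt (d := d) hK hb le_rfl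
  have hX2 : X 2 0 + der 2 r.x 0 = ((ubar g K r d q₀ 0 • (R2 (q₀.ψ 0) * S)) *ᵥ tilt q₀ 0) 0 := by
    rw [hX 2 (by norm_num)]
    simp [errorChain, accXY]
  have hY2 : Y 2 0 + der 2 r.y 0 = ((ubar g K r d q₀ 0 • (R2 (q₀.ψ 0) * S)) *ᵥ tilt q₀ 0) 1 := by
    rw [hY 2 (by norm_num)]
    simp [errorChain, accXY]
  have etilt : plannedTilt₀ g K r X Y Z Ψ 0 = tan p.θ ∧
      plannedTilt₁ g K r X Y Z Ψ 0 = tan p.φ / cos p.θ := by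
    have eψ0 : Ψ 0 0 = q₀.ψ 0 := eψ
    rw [plannedTilt₀, plannedTilt₁, hX2, hY2, thrust_tilt_apply, ← h.ubar_eq (d := d) le_rfl, ← hq,
      eU, eψ0, hi.φ, hi.θ]
    simp only [cons_val_zero, cons_val_one]
    constructor
    · field_simp
      linear_combination (tan p.θ * cos p.θ) * sin_sq_add_cos_sq (q₀.ψ 0)
    · field_simp
      linear_combination (tan p.φ) * sin_sq_add_cos_sq (q₀.ψ 0)
  have eθ : q.θ 0 = p.θ := by
    change arctan (plannedTilt₀ g K r X Y Z Ψ 0) = _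
    rw [etilt.1, arctan_tan hθ.1 hθ.2]
  have eφ : q.φ 0 = p.φ := by
    change arctan (plannedTilt₁ g K r X Y Z Ψ 0 *
      cos (arctan (plannedTilt₀ g K r X Y Z Ψ 0))) = _
    rw [etilt.1, etilt.2, arctan_tan hθ.1 hθ.2, div_mul_cancel₀ _ hcosθ, arctan_tan hφ.1 hφ.2]
  have hXi : Xi1 g K r d q 0 = Xi1 g K r d q₀ 0 :=
    Xi1_congr ez ez' eψ eψ' (eφ.trans hi.φ.symm) (eθ.trans hi.θ.symm)
  have hjerk : jerkXY g K r d q 0 = jerkXY g K r d q₀ 0 := by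
    rw [hq, h.jerkXY_eq hK hr hb le_rfl, hX 3 (by norm_num), hY 3 (by norm_num)]
    ext i
    fin_cases i <;> rfl
  -- In the third derivatives everything but the rates is already known to agree at time `0`, and
  -- the matrix in front of the rates is invertible.
  have erates : rates q 0 = rates q₀ 0 := by
    have hM : Mt q 0 = M p.φ p.θ := by rw [Mt, eφ, eθ]
    have hM₀ : Mt q₀ 0 = M p.φ p.θ := by rw [Mt, hi.φ, hi.θ]
    rw [jerkXY, jerkXY, hXi, sub_left_inj, add_right_inj, eU, eψ, hM, hM₀] at hjerk
    rw [thrust_mulVec_eq_iff hcosφ hcosθ hU] at hjerk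
    rw [hjerk]
    exact ((thrust_mulVec_eq_iff hcosφ hcosθ hU _ _).1 rfl).symm
  have hdz := (timesDiff_sub_sub_const (c := d.z) (der_uniform p.z v.z).1
    (hr.smooth_z.1.mono (by norm_num : 2 ≤ 4))).2 1 (by simp) 0 le_rfl
  have hdx := (timesDiff_sub_sub_const (c := d.x) (der_uniform p.x v.x).1
    (hr.smooth_x.1.mono (by norm_num : 2 ≤ 4))).2 1 (by simp) 0 le_rfl
  have hdy := (timesDiff_sub_sub_const (c := d.y) (der_uniform p.y v.y).1
    (hr.smooth_y.1.mono (by norm_num : 2 ≤ 4))).2 1 (by simp) 0 le_rfl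
  rw [(der_uniform _ _).2] at hdx hdy hdz
  have hx := (timesDiff_chain_add_add_const d.x (fun k (hk : k < 2) => h.x k (by omega))
    (hr.smooth_x.1.mono (by norm_num : 2 ≤ 4))).2 1 (by simp) 0 le_rfl
  have hy := (timesDiff_chain_add_add_const d.y (fun k (hk : k < 2) => h.y k (by omega))
    (hr.smooth_y.1.mono (by norm_num : 2 ≤ 4))).2 1 (by simp) 0 le_rfl
  have hz := (timesDiff_chain_add_add_const d.z h.z
    (hr.smooth_z.1.mono (by norm_num : 2 ≤ 4))).2 1 (by simp) 0 le_rfl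
  have hX1 : X 1 0 = v.x - der 1 r.x 0 := (hX 1 (by norm_num)).trans hdx
  have hY1 : Y 1 0 = v.y - der 1 r.y 0 := (hY 1 (by norm_num)).trans hdy
  have hZ1 : Z 1 0 = v.z - der 1 r.z 0 := (hZ 1 (by norm_num)).trans hdz
  refine ⟨q, h.closedLoop hK hr hb, ⟨?_, ?_, ?_, eφ, eθ, eψ.trans hi.ψ, ?_, ?_, ?_,
    (congrFun erates 0).trans hi.dφ, (congrFun erates 1).trans hi.dθ, eψ'.trans hi.dψ⟩,
    upright_plannedTrajectory g K r d X Y Z Ψ⟩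
  · change X 0 0 + r.x 0 + d.x = p.x
    rw [hX 0 (by norm_num)]
    simp only [errorChain, errX, hi.x]
    ring
  · change Y 0 0 + r.y 0 + d.y = p.y
    rw [hY 0 (by norm_num)]
    simp only [errorChain, errY, hi.y]
    ring
  · change Z 0 0 + r.z 0 + d.z = p.z
    rw [hZ 0 (by norm_num), der_zero]
    simp only [errZ, hi.z]
    ring
  · refine hx.trans ?_
    rw [hX1]
    ring
  · refine hy.trans ?_
    rw [hY1]
    ring
  · refine hz.trans ?_
    rw [hZ1]
    ring

end Quadrotor

theorem theorem1 (g : ℝ) (K : Quadrotor.Gains) (hK : K.Admissible) :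
    -- every initial state starts a closed-loop motion on `[0, ∞)` that meets no singularity
    (∀ (r : Quadrotor.Reference) (d : Quadrotor.Offset) (p v : Quadrotor.Config),
      r.Admissible g → Quadrotor.ThrustBound g K r →
      p.φ ∈ Set.Ioo (-(Real.pi / 2)) (Real.pi / 2) →
      p.θ ∈ Set.Ioo (-(Real.pi / 2)) (Real.pi / 2) →
      ∃ q : Quadrotor.Trajectory, Quadrotor.ClosedLoop g K r d q ∧ q.HasInitialState p v ∧
        ∀ t ≥ 0, q.φ t ∈ Set.Ioo (-(Real.pi / 2)) (Real.pi / 2) ∧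
          q.θ t ∈ Set.Ioo (-(Real.pi / 2)) (Real.pi / 2)) ∧
    -- convergence of the tracking errors and of the yaw angle
    (∀ (r : Quadrotor.Reference) (d : Quadrotor.Offset) (q : Quadrotor.Trajectory),
      Quadrotor.Tracks g K r d q →
      Filter.Tendsto (fun t => q.x t - r.x t) Filter.atTop (nhds d.x) ∧
      Filter.Tendsto (fun t => q.y t - r.y t) Filter.atTop (nhds d.y) ∧
      Filter.Tendsto (fun t => q.z t - r.z t) Filter.atTop (nhds d.z) ∧
      Filter.Tendsto q.ψ Filter.atTop (nhds 0)) ∧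
    -- the horizontal errors and their first three derivatives decay exponentially, uniformly
    (∃ C > 0, ∃ c > 0,
      ∀ (r : Quadrotor.Reference) (d : Quadrotor.Offset) (q : Quadrotor.Trajectory),
      Quadrotor.Tracks g K r d q →
      Quadrotor.TimesDiff 4 (Quadrotor.errX r d q) ∧
      Quadrotor.TimesDiff 4 (Quadrotor.errY r d q) ∧
      ∀ k < 4, ∀ t ≥ 0,
        |Quadrotor.der k (Quadrotor.errX r d q) t| ≤ C * Real.exp (-c * t) *
          ∑ j ∈ Finset.range 4, |Quadrotor.der j (Quadrotor.errX r d q) 0| ∧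
        |Quadrotor.der k (Quadrotor.errY r d q) t| ≤ C * Real.exp (-c * t) *
          ∑ j ∈ Finset.range 4, |Quadrotor.der j (Quadrotor.errY r d q) 0|) ∧
    -- the altitude error and its first two derivatives are stable ...
    (∀ ε > 0, ∃ δ > 0,
      ∀ (r : Quadrotor.Reference) (d : Quadrotor.Offset) (q : Quadrotor.Trajectory),
      Quadrotor.Tracks g K r d q →
      |Quadrotor.errZ r d q 0| < δ → |Quadrotor.der 1 (Quadrotor.errZ r d q) 0| < δ →
      ∀ k < 3, ∀ t ≥ 0, |Quadrotor.der k (Quadrotor.errZ r d q) t| < ε) ∧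
    -- ... and converge to zero, uniformly on bounded sets of initial altitude errors
    (∀ ρ > 0, ∀ ε > 0, ∃ T ≥ 0,
      ∀ (r : Quadrotor.Reference) (d : Quadrotor.Offset) (q : Quadrotor.Trajectory),
      Quadrotor.Tracks g K r d q →
      |Quadrotor.errZ r d q 0| < ρ → |Quadrotor.der 1 (Quadrotor.errZ r d q) 0| < ρ →
      ∀ k < 3, ∀ t ≥ T, |Quadrotor.der k (Quadrotor.errZ r d q) t| < ε) := by
  refine ⟨fun r d p v hr hb hφ hθ => ?_, fun r d q h => ?_, ?_, fun ε hε => ?_,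
    fun ρ _ ε hε => ?_⟩
  · obtain ⟨q, hq, hi, hup⟩ := Quadrotor.exists_closedLoop hK d (v := v) hr hb hφ hθ
    exact ⟨q, hq, hi, fun t _ => hup t⟩
  · obtain ⟨hx, hy, hz⟩ := h.tendsto_errors hK
    refine ⟨?_, ?_, ?_, h.tendsto_yaw hK⟩
    · simpa [Quadrotor.errX] using hx.add_const d.x
    · simpa [Quadrotor.errY] using hy.add_const d.y
    · simpa [Quadrotor.errZ] using hz.add_const d.z
  · exact Quadrotor.exists_horizontal_bound g hK
  · obtain ⟨δ, hδ, H⟩ := Quadrotor.altitudeError_stable hK.k1z_pos hK.k2z_pos hK.k3z_pos hε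
    exact ⟨δ, hδ, fun r d q h h0 h1 k hk t ht =>
      h.abs_der_errZ_lt hK ht (H _ _ (h.isAltitudeError hK) h0 h1 t ht) k hk⟩
  · obtain ⟨T, hT, H⟩ :=
      Quadrotor.altitudeError_attractive hK.k1z_pos hK.k2z_pos hK.k3z_pos ρ hε
    exact ⟨T, hT, fun r d q h h0 h1 k hk t ht =>
      h.abs_der_errZ_lt hK (hT.trans ht) (H _ _ (h.isAltitudeError hK) h0 h1 t ht) k hk⟩
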